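/- For an integer $n\ge 0$ and $\alpha\in[-1,1]$ let $p_n(x;\alpha)=\sum_{j=0}^n c_j(\alpha)x^j$ be the minimax polynomial of the checkmark function, i.e. the best uniform approximation to $f(x)=|x-\alpha|$ on $[-1,1]$ among real polynomials of degree at most $n$, and let $E_n(\alpha)=\max_{x\in[-1,1]}\bigl||x-\alpha|-p_n(x;\alpha)\bigr|$ be the minimax error. The alternation set $\mathcal A_n(\alpha)$ is the set of all points that occur in some system $-1\le z_1<z_2<\dots<z_N\le 1$ with $N\ge n+2$ and $|z_i-\alpha|-p_n(z_i;\alpha)=\epsilon(-1)^iE_n(\alpha)$ for $i=1,\dots,N$, where $\epsilon\in\{1,-1\}$. A V-shape of $E_n$ with left endpoint $a$, tip $b$ and right endpoint $c$, where $-1\le a<b<c\le 1$, means that $E_n$ is affine and decreasing on $[a,b]$ and affine and increasing on $[b,c]$, and that $[a,c]$ is maximal: no strictly larger interval in $[-1,1]$ splits in the same way at some interior point. Theorem. Let $n\ge 0$ and let $\alpha_0\in(-1,1)$ be neither an endpoint nor the tip of a V-shape of $E_n$. Then: (1) $E_n$ is real analytic at $\alpha_0$. (2) There are functions $z_1,\dots,z_{n+2}$,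 real analytic at $\alpha_0$, such that for all $\alpha$ in a neighbourhood of $\alpha_0$ one has $z_1(\alpha)<\dots<z_{n+2}(\alpha)$ and $\mathcal A_n(\alpha)=\{z_1(\alpha),\dots,z_{n+2}(\alpha)\}$. (3) The coefficients $c_0,\dots,c_n$ of the minimax polynomial are real analytic at $\alpha_0$. -/

import Mathlib

open Set Filter Topology Polynomial

noncomputable section

namespace Checkmark

/-- The checkmark function `x ↦ |x - α|` as a continuous function on `[-1, 1]`. The norm on
`C(Icc (-1) 1, ℝ)` is the uniform norm. -/
def checkmark (α : ℝ) : C(Icc (-1 : ℝ) 1, ℝ) :=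
  ⟨fun x => |(x : ℝ) - α|, by fun_prop⟩

/-- `p` is a best uniform approximation to `|x - α|` on `[-1, 1]` among the real polynomials of
degree at most `n`. -/
def IsMinimax (n : ℕ) (α : ℝ) (p : ℝ[X]) : Prop :=
  p ∈ degreeLE ℝ n ∧
    ∀ q ∈ degreeLE ℝ n,
      ‖checkmark α - p.toContinuousMapOn (Icc (-1 : ℝ) 1)‖ ≤
        ‖checkmark α - q.toContinuousMapOn (Icc (-1 : ℝ) 1)‖

theorem exists_isMinimax (n : ℕ) (α : ℝ) : ∃ p, IsMinimax n α p := by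
  let L : ℝ[X] →ₗ[ℝ] C(Icc (-1 : ℝ) 1, ℝ) :=
    (toContinuousMapOnAlgHom (R := ℝ) (Icc (-1 : ℝ) 1)).toLinearMap
  have : FiniteDimensional ℝ (degreeLE ℝ (n : WithBot ℕ)) := by
    rw [degreeLE_eq_span_X_pow]
    exact FiniteDimensional.span_finset ℝ _
  let S := (degreeLE ℝ (n : WithBot ℕ)).map L
  have : ProperSpace S := FiniteDimensional.proper ℝ S
  have hcont : Continuous fun s : S => ‖checkmark α - (s : C(Icc (-1 : ℝ) 1, ℝ))‖ := by
    fun_prop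
  have hlim : Tendsto (fun s : S => ‖checkmark α - (s : C(Icc (-1 : ℝ) 1, ℝ))‖)
      (cocompact S) atTop := by
    refine tendsto_atTop_mono (f := fun s : S => ‖s‖ - ‖checkmark α‖) (fun s => ?_) ?_
    · have := norm_sub_norm_le (s : C(Icc (-1 : ℝ) 1, ℝ)) (checkmark α)
      rw [norm_sub_rev] at this
      exact this
    · exact tendsto_atTop_add_const_right _ _ (tendsto_norm_cocompact_atTop (E := S))
  obtain ⟨⟨_, p, hp, rfl⟩, hmin⟩ := hcont.exists_forall_le hlim
  exact ⟨p, hp, fun q hq => hmin ⟨L q, q, hq, rfl⟩⟩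

/-- The minimax polynomial `p_n(·; α)`. -/
def minimaxPoly (n : ℕ) (α : ℝ) : ℝ[X] :=
  (exists_isMinimax n α).choose

/-- The minimax error `E_n(α) = ‖|· - α| - p_n(·; α)‖`. -/
def minimaxError (n : ℕ) (α : ℝ) : ℝ :=
  ‖checkmark α - (minimaxPoly n α).toContinuousMapOn (Icc (-1 : ℝ) 1)‖

/-- `z 0 < z 1 < ⋯` are points of `[-1, 1]` at which the error `|x - α| - p_n(x; α)` takes the
values `± E_n(α)` with alternating signs. -/
def IsAlternation (n : ℕ) (α : ℝ) {N : ℕ} (z : Fin N → ℝ) : Prop :=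
  StrictMono z ∧ (∀ i, z i ∈ Icc (-1 : ℝ) 1) ∧
    ∃ ε : ℝ, (ε = 1 ∨ ε = -1) ∧
      ∀ i, |z i - α| - (minimaxPoly n α).eval (z i) =
        ε * (-1) ^ (i : ℕ) * minimaxError n α

/-- The alternation set `𝒜_n(α)`: all points that occur in an alternation of length at least
`n + 2`. -/
def alternationSet (n : ℕ) (α : ℝ) : Set ℝ :=
  {x | ∃ (N : ℕ) (z : Fin N → ℝ), n + 2 ≤ N ∧ IsAlternation n α z ∧ x ∈ range z}

/-- On `[a, c] ⊆ [-1, 1]` the function `g` is affine and decreasing on `[a, b]` and affine and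
increasing on `[b, c]`, where `a < b < c`. -/
structure IsVOn (g : ℝ → ℝ) (a b c : ℝ) : Prop where
  left_mem : -1 ≤ a
  left_lt : a < b
  lt_right : b < c
  right_mem : c ≤ 1
  decreasing : ∃ m k : ℝ, m < 0 ∧ ∀ x ∈ Icc a b, g x = m * x + k
  increasing : ∃ m k : ℝ, 0 < m ∧ ∀ x ∈ Icc b c, g x = m * x + k

/-- The graph of `g` over `[-1, 1]` has a V-shape with left endpoint `a`, tip `b` and right
endpoint `c`: the interval `[a, c]` is a maximal one on which `g` has the form of a V. -/
def IsVShape (g : ℝ → ℝ) (a b c : ℝ) : Prop :=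
  IsVOn g a b c ∧
    ∀ a' b' c', IsVOn g a' b' c' → a' ≤ a → c ≤ c' → a' = a ∧ c' = c

end Checkmark

end

/-!
The minimax polynomial `p` is characterised by equioscillation: the error takes the values
`± E_n(α)` with alternating signs at `n + 2` points. Extremal points lie among `-1`, `α`, `1` and
the critical points, which are the zeros of `p' + 1` to the left of `α` and of `p' - 1` to its
right. By Rolle's theorem there are at most `n` critical points, hence at most `n + 3` extremal
points.

An affine map fixing one of the endpoints `± 1` carries checkmarks to checkmarks, up to a factor.
If there are `n + 3` extremal points, then stretching until the outermost one leaves `[-1, 1]` keeps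
an alternation of length `n + 2`, so `E_n` is affine on either side of `α`, and `α` is the tip of a
V. If there are `n + 2` of them and `1` is a critical point, then the error may be continued beyond
`1` up to a point where it reaches its extremal value again; shrinking up to there turns `α` into
the tip of a V, so `α` is the right endpoint of a V. Symmetrically for `-1`.

In the remaining case all extremal points are nondegenerate. The coefficients of `p`, the signed
error and the extremal points then solve a square system of equations depending analytically on
`α`, whose derivative is injective because a polynomial of degree at most `n` with
`q(z_i) = (-1)^i η` at `n + 2` increasing points vanishes. The implicit function theorem applies.
-/

open scoped ContDiff

noncomputable section

namespace Checkmark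

theorem exists_eval_mul_eval_nonneg {n : ℕ} {q : ℝ[X]} (hq : q.natDegree ≤ n)
    {z : Fin (n + 2) → ℝ} (hz : StrictMono z) :
    ∃ i : Fin (n + 1), 0 ≤ q.eval (z i.castSucc) * q.eval (z i.succ) := by
  by_contra! hneg
  have exists_root : ∀ i : Fin (n + 1), ∃ w ∈ Ioo (z i.castSucc) (z i.succ), q.eval w = 0 := by
    intro i
    have hlt : z i.castSucc < z i.succ := hz Fin.castSucc_lt_succ
    rcases mul_neg_iff.1 (hneg i) with ⟨hl, hr⟩ | ⟨hl, hr⟩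
    · exact intermediate_value_Ioo' hlt.le q.continuous.continuousOn ⟨hr, hl⟩
    · exact intermediate_value_Ioo hlt.le q.continuous.continuousOn ⟨hl, hr⟩
  choose w hw hw0 using exists_root
  have hwm : StrictMono w := fun i j hij =>
    (hw i).2.trans_le ((hz.monotone (Fin.succ_le_castSucc_iff.2 hij)).trans (hw j).1.le)
  have hq0 : q = 0 := eq_zero_of_natDegree_lt_card_of_eval_eq_zero q hwm.injective hw0
    (by simpa using Nat.lt_succ_of_le hq)
  simpa [hq0] using hneg 0

/-- A finite increasing list of points of `K` along which the sign of `h` alternates strictly.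
It is a list rather than a family over `Fin`, since such chains are built by prepending points. -/
def IsSignChain (h : ℝ → ℝ) (K : Set ℝ) (l : List ℝ) : Prop :=
  (∀ x ∈ l, x ∈ K) ∧ l.IsChain fun a b => a < b ∧ h a * h b < 0

theorem IsSignChain.cons {h : ℝ → ℝ} {K : Set ℝ} {s a : ℝ} {l : List ℝ}
    (hl : IsSignChain h K (a :: l)) (hs : s ∈ K) (hsa : s < a) (hneg : h s * h a < 0) :
    IsSignChain h K (s :: a :: l) :=
  ⟨List.forall_mem_cons.2 ⟨hs, hl.1⟩, List.isChain_cons_cons.2 ⟨⟨hsa, hneg⟩, hl.2⟩⟩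

theorem IsSignChain.mono {h : ℝ → ℝ} {K L : Set ℝ} {l : List ℝ} (hl : IsSignChain h K l)
    (hKL : K ⊆ L) : IsSignChain h L l :=
  ⟨fun x hx => hKL (hl.1 x hx), hl.2⟩

theorem IsSignChain.exists_length_succ {h : ℝ → ℝ} {K : Set ℝ} {s t : ℝ} {l : List ℝ}
    (h0 : ∀ x ∈ K, h x ≠ 0) (hs : s ∈ K) (ht : t ∈ K) (hst : s < t) (hneg : h s * h t < 0)
    (hl : IsSignChain h (K ∩ Ici t) l) : ∃ l', l'.length = l.length + 1 ∧ IsSignChain h K l' := by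
  have hlK := hl.mono inter_subset_left
  obtain _ | ⟨a, l⟩ := l
  · exact ⟨[s], rfl, by simpa using hs, .singleton _⟩
  obtain ⟨haK, hta⟩ := hl.1 a List.mem_cons_self
  rcases lt_or_ge (h s * h a) 0 with hsa | hsa
  · exact ⟨s :: a :: l, rfl, hlK.cons hs (hst.trans_le hta) hsa⟩
  · have hne : t ≠ a := by rintro rfl; exact hneg.not_ge hsa
    have hta_neg : h t * h a < 0 := by
      have hpos : 0 < h s * h a := hsa.lt_of_ne (mul_ne_zero (h0 s hs) (h0 a haK)).symm
      have hprod : (h t * h a) * (h s * h s) < 0 := by nlinarith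
      exact (neg_iff_pos_of_mul_neg hprod).2 (mul_self_pos.2 (h0 s hs))
    exact ⟨t :: a :: l, rfl, hlK.cons ht (hta.lt_of_ne hne) hta_neg⟩

theorem exists_first_sign_change {h : ℝ → ℝ} {K : Set ℝ} {s : ℝ} (hK : IsCompact K)
    (hc : ContinuousOn h K) (h0 : ∀ x ∈ K, h x ≠ 0) (hs : IsLeast K s) :
    (∀ x ∈ K, 0 < h s * h x) ∨ ∃ t ∈ K, s < t ∧ h s * h t < 0 ∧
      ∃ r < t, ∀ x ∈ K, x < t → x < r ∧ 0 < h s * h x := by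
  have hcs : ContinuousOn (fun x => h s * h x) K := continuousOn_const.mul hc
  have hs_pos : 0 < h s * h s := mul_self_pos.2 (h0 s hs.1)
  have hneg_compact : IsCompact {x ∈ K | h s * h x ≤ 0} :=
    hK.of_isClosed_subset (hcs.preimage_isClosed_of_isClosed hK.isClosed isClosed_Iic)
      inter_subset_left
  rcases {x ∈ K | h s * h x ≤ 0}.eq_empty_or_nonempty with hempty | hne
  · exact Or.inl fun x hx => not_le.1 fun hle => eq_empty_iff_forall_notMem.1 hempty x ⟨hx, hle⟩
  obtain ⟨t, ⟨htK, ht⟩, ht_least⟩ := hneg_compact.exists_isLeast hne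
  have hpos_below : ∀ x ∈ K, x < t → 0 < h s * h x := fun x hx hxt =>
    not_le.1 fun hle => (ht_least ⟨hx, hle⟩).not_gt hxt
  have hst : s < t := (hs.2 htK).lt_of_ne (by rintro rfl; exact ht.not_gt hs_pos)
  have hpos_compact : IsCompact {x ∈ K ∩ Iic t | 0 ≤ h s * h x} :=
    hK.of_isClosed_subset ((hcs.mono inter_subset_left).preimage_isClosed_of_isClosed
      (hK.isClosed.inter isClosed_Iic) isClosed_Ici) (inter_subset_left.trans inter_subset_left)
  obtain ⟨u, ⟨⟨-, hut⟩, hu⟩, hu_greatest⟩ :=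
    hpos_compact.exists_isGreatest ⟨s, ⟨hs.1, hst.le⟩, hs_pos.le⟩
  have ht_neg : h s * h t < 0 := ht.lt_of_ne (mul_ne_zero (h0 s hs.1) (h0 t htK))
  have hut' : u < t := lt_of_le_of_ne hut fun hut => (hut ▸ hu).not_gt ht_neg
  obtain ⟨r, hur, hrt⟩ := exists_between hut'
  exact Or.inr ⟨t, htK, hst, ht_neg, r, hrt, fun x hx hxt =>
    ⟨(hu_greatest ⟨⟨hx, hxt.le⟩, (hpos_below x hx hxt).le⟩).trans_lt hur, hpos_below x hx hxt⟩⟩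

theorem eval_mul_X_sub_C_mul_pos {q : ℝ[X]} {r y a b c : ℝ} (hyr : y < r)
    (hq : 0 < q.eval y * b) (hab : a * b < 0) (hac : 0 < a * c) :
    0 < (q * (X - C r)).eval y * c := by
  have hprod : 0 < (q.eval y * (y - r) * c) * (a * a * (b * b)) := by
    have := mul_pos (mul_pos (mul_pos hq (sub_pos.2 hyr)) hac) (neg_pos.2 hab)
    linarith
  have hsq : 0 < a * a * (b * b) := mul_pos (mul_self_pos.2 (left_ne_zero_of_mul hab.ne))
    (mul_self_pos.2 (right_ne_zero_of_mul hab.ne))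
  simpa using (pos_iff_pos_of_mul_pos hprod).2 hsq

-- The last clause, a sign to the left of `K`, is there for the induction.
theorem exists_polynomial_same_sign {h : ℝ → ℝ} (m : ℕ) {K : Set ℝ} (hK : IsCompact K)
    (hc : ContinuousOn h K) (h0 : ∀ x ∈ K, h x ≠ 0)
    (hchain : ∀ l, IsSignChain h K l → l.length ≠ m + 1) :
    ∃ q : ℝ[X], q.degree < m ∧ (∀ x ∈ K, 0 < q.eval x * h x) ∧
      ∀ s, IsLeast K s → ∀ y ≤ s, 0 < q.eval y * h s := by
  induction m generalizing K with
  | zero =>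
    have hempty : ∀ x, x ∉ K := fun x hx =>
      hchain [x] ⟨by simpa using hx, .singleton x⟩ rfl
    exact ⟨0, by simp, fun x hx => (hempty x hx).elim, fun x hx => (hempty x hx.1).elim⟩
  | succ m ih =>
    rcases K.eq_empty_or_nonempty with rfl | hne
    · exact ⟨0, by simp, by simp, fun x hx => hx.1.elim⟩
    obtain ⟨s, hs⟩ := hK.exists_isLeast hne
    suffices ∃ q : ℝ[X], q.degree < (m + 1 : ℕ) ∧ (∀ x ∈ K, 0 < q.eval x * h x) ∧
        ∀ y ≤ s, 0 < q.eval y * h s by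
      obtain ⟨q, hdeg, hq, hleft⟩ := this
      exact ⟨q, hdeg, hq, fun x hx => hx.unique hs ▸ hleft⟩
    rcases exists_first_sign_change hK hc h0 hs with hpos | ⟨t, htK, hst, hneg, r, hrt, hbelow⟩
    · refine ⟨C (h s), degree_C_lt.trans_le ?_, fun x hx => ?_, fun y _ => ?_⟩
      · exact_mod_cast Nat.succ_le_succ (Nat.zero_le m)
      · simpa using hpos x hx
      · simpa using hpos s hs.1
    obtain ⟨q, hdeg, hq, hq_left⟩ := ih (hK.inter_right isClosed_Ici) (hc.mono inter_subset_left)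
      (fun x hx => h0 x hx.1) fun l hl hlen => by
        obtain ⟨l', hlen', hl'⟩ := hl.exists_length_succ h0 hs.1 htK hst hneg
        exact hchain l' hl' (by rw [hlen', hlen])
    have hqt := hq_left t ⟨⟨htK, self_mem_Ici⟩, fun x hx => hx.2⟩
    have hleft : ∀ x ∈ K, x < t → ∀ y ≤ x, 0 < (q * (X - C r)).eval y * h x := by
      intro x hx hxt y hyx
      obtain ⟨hxr, hsx⟩ := hbelow x hx hxt
      exact eval_mul_X_sub_C_mul_pos (hyx.trans_lt hxr) (hqt y (hyx.trans hxt.le)) hneg hsx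
    refine ⟨q * (X - C r), ?_, fun x hx => ?_, hleft s hs.1 hst⟩
    · rw [degree_mul, degree_X_sub_C, Nat.cast_succ]
      exact WithBot.add_lt_add_right (by simp) hdeg
    · rcases lt_or_ge x t with hxt | hxt
      · exact hleft x hx hxt x le_rfl
      · have := mul_pos (hq x ⟨hx, hxt⟩) (sub_pos.2 (hrt.trans_le hxt))
        simp only [eval_mul, eval_sub, eval_X, eval_C]
        linarith

/-- The function `e` takes the values `± E` with alternating signs at the increasing points `z` of
`K`. With `e` the error of the minimax polynomial this is `IsAlternation`. -/
structure Alternates (e : ℝ → ℝ) (K : Set ℝ) (E : ℝ) {N : ℕ} (z : Fin N → ℝ) : Prop where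
  strictMono : StrictMono z
  mem : ∀ i, z i ∈ K
  sign : ∃ ε : ℝ, (ε = 1 ∨ ε = -1) ∧ ∀ i, e (z i) = ε * (-1) ^ (i : ℕ) * E

theorem Alternates.abs_eq {e : ℝ → ℝ} {K : Set ℝ} {E : ℝ} {N : ℕ} {z : Fin N → ℝ}
    (h : Alternates e K E z) (hE : 0 ≤ E) (i : Fin N) : |e (z i)| = E := by
  obtain ⟨ε, rfl | rfl, hs⟩ := h.sign <;> simp [hs, abs_mul, abs_of_nonneg hE]

theorem Alternates.succ_eq_neg {e : ℝ → ℝ} {K : Set ℝ} {E : ℝ} {N : ℕ} {z : Fin (N + 1) → ℝ}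
    (h : Alternates e K E z) (i : Fin N) : e (z i.succ) = -e (z i.castSucc) := by
  obtain ⟨ε, -, hs⟩ := h.sign
  simp [hs, pow_succ]

theorem eq_neg_one_pow_mul {e : ℝ → ℝ} {N : ℕ} {z : Fin (N + 1) → ℝ}
    (h : ∀ i : Fin N, e (z i.succ) = -e (z i.castSucc)) (i : Fin (N + 1)) :
    e (z i) = (-1) ^ (i : ℕ) * e (z 0) := by
  induction i using Fin.induction with
  | zero => simp
  | succ i ih => rw [h, ih]; simp [pow_succ]

theorem Alternates.of_succ_eq_neg {e : ℝ → ℝ} {K : Set ℝ} {E : ℝ} {N : ℕ} {z : Fin (N + 1) → ℝ}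
    (hz : StrictMono z) (hmem : ∀ i, z i ∈ K) (h0 : |e (z 0)| = E)
    (h : ∀ i : Fin N, e (z i.succ) = -e (z i.castSucc)) : Alternates e K E z := by
  refine ⟨hz, hmem, ?_⟩
  rcases abs_choice (e (z 0)) with hsign | hsign
  · exact ⟨1, Or.inl rfl, fun i => by rw [eq_neg_one_pow_mul h, ← h0, hsign]; ring⟩
  · exact ⟨-1, Or.inr rfl, fun i => by rw [eq_neg_one_pow_mul h, ← h0, hsign]; ring⟩

theorem IsSignChain.exists_alternates {e : ℝ → ℝ} {K : Set ℝ} {E : ℝ} {N : ℕ} {l : List ℝ}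
    (hl : IsSignChain e {x ∈ K | |e x| = E} l) (hlen : l.length = N + 1) :
    ∃ z : Fin (N + 1) → ℝ, Alternates e K E z := by
  obtain ⟨hmem, hchain⟩ := hl
  rw [List.isChain_iff_getElem] at hchain
  have hz : ∀ i : Fin (N + 1), l[(i : ℕ)] ∈ {x ∈ K | |e x| = E} :=
    fun i => hmem _ (List.getElem_mem _)
  refine ⟨fun i => l[(i : ℕ)], .of_succ_eq_neg (Fin.strictMono_iff_lt_succ.2 fun i =>
    (hchain i (by omega)).1) (fun i => (hz i).1) (hz 0).2 fun i => ?_⟩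
  have habs := (hz i.succ).2.trans (hz i.castSucc).2.symm
  refine (abs_eq_abs.1 habs).resolve_left fun heq => (hchain i (by omega)).2.not_ge ?_
  rw [show e l[(i : ℕ) + 1] = e l[(i : ℕ)] from heq]
  exact mul_self_nonneg _

theorem exists_abs_sub_mul_lt {Y : Type*} [TopologicalSpace Y] [CompactSpace Y] {e q : Y → ℝ}
    {E : ℝ} (he : Continuous e) (hq : Continuous q) (hle : ∀ x, |e x| ≤ E)
    (hsign : ∀ x, |e x| = E → 0 < q x * e x) : ∃ τ : ℝ, ∀ x, |e x - τ * q x| < E := by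
  have heventually : ∀ᶠ τ in 𝓝 (0 : ℝ), ∀ x ∈ univ, 0 < τ → |e x - τ * q x| < E := by
    refine isCompact_univ.eventually_forall_of_forall_eventually fun x _ => ?_
    rcases (hle x).lt_or_eq with hlt | heq
    · have hcont : Continuous fun w : ℝ × Y => |e w.2 - w.1 * q w.2| := by fun_prop
      have := hcont.continuousAt.eventually_lt (x₀ := (0, x)) continuousAt_const (by simpa)
      exact this.mono fun w hw _ => hw
    · have hcont : Continuous fun w : ℝ × Y => w.1 * q w.2 ^ 2 - 2 * (q w.2 * e w.2) := by fun_prop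
      have := hcont.continuousAt.eventually_lt (x₀ := (0, x)) (g := fun _ => 0)
        continuousAt_const (by simpa using hsign x heq)
      -- `(e - τ q)² = e² + τ (τ q² - 2 q e)`
      filter_upwards [this] with w hw hτ
      refine abs_lt_of_sq_lt_sq ?_ ((abs_nonneg _).trans (hle w.2))
      have hsq := sq_le_sq' (abs_le.1 (hle w.2)).1 (abs_le.1 (hle w.2)).2
      nlinarith [mul_neg_of_pos_of_neg hτ hw]
  obtain ⟨τ, hτ, hτ_pos⟩ := ((heventually.filter_mono nhdsWithin_le_nhds).and
    (self_mem_nhdsWithin (a := (0 : ℝ)) (s := Ioi 0))).exists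
  exact ⟨τ, fun x => hτ x (mem_univ x) hτ_pos⟩

section BestApproximation

variable {n : ℕ} {f : ℝ → ℝ} {K : Set ℝ} {p : ℝ[X]} {E : ℝ}

theorem Alternates.exists_le_abs_sub {z : Fin (n + 2) → ℝ}
    (h : Alternates (fun x => f x - p.eval x) K E z) (hE : 0 ≤ E) (hp : p.natDegree ≤ n)
    {q : ℝ[X]} (hq : q.natDegree ≤ n) : ∃ x ∈ K, E ≤ |f x - q.eval x| := by
  by_contra! hlt
  have hdeg : (p - q).natDegree ≤ n := natDegree_sub_le_iff_left hq |>.2 hp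
  obtain ⟨i, hi⟩ := exists_eval_mul_eval_nonneg hdeg h.strictMono
  refine hi.not_gt ?_
  have hl := abs_lt.1 (hlt _ (h.mem i.castSucc))
  have hr := abs_lt.1 (hlt _ (h.mem i.succ))
  have hsucc := h.succ_eq_neg i
  rw [eval_sub, eval_sub]
  rcases eq_or_eq_neg_of_abs_eq (h.abs_eq hE i.castSucc) with heq | heq
  · exact mul_neg_of_neg_of_pos (by linarith) (by linarith)
  · exact mul_neg_of_pos_of_neg (by linarith) (by linarith)

theorem exists_alternates_of_forall_exists_le (hK : IsCompact K) (hf : ContinuousOn f K)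
    (hE : 0 < E) (hp : p.natDegree ≤ n) (hle : ∀ x ∈ K, |f x - p.eval x| ≤ E)
    (hbest : ∀ q : ℝ[X], q.natDegree ≤ n → ∃ x ∈ K, E ≤ |f x - q.eval x|) :
    ∃ z : Fin (n + 2) → ℝ, Alternates (fun x => f x - p.eval x) K E z := by
  set e : ℝ → ℝ := fun x => f x - p.eval x
  have he : ContinuousOn e K := hf.sub p.continuous.continuousOn
  have hS : IsCompact {x ∈ K | |e x| = E} := hK.of_isClosed_subset
    (he.abs.preimage_isClosed_of_isClosed hK.isClosed isClosed_singleton) inter_subset_left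
  by_contra hnot
  obtain ⟨q, hq_deg, hq, -⟩ := exists_polynomial_same_sign (n + 1) hS
    (he.mono inter_subset_left) (fun x hx h0 => hE.ne (by simpa [h0] using hx.2))
    fun l hl hlen => hnot (hl.exists_alternates hlen)
  have : CompactSpace K := isCompact_iff_compactSpace.1 hK
  obtain ⟨τ, hτ⟩ := exists_abs_sub_mul_lt he.domRestrict (q := K.domRestrict fun x => q.eval x)
    q.continuous.continuousOn.domRestrict (fun x => hle x x.2) fun x hx => hq x ⟨x.2, hx⟩
  have hdeg : (p + C τ * q).natDegree ≤ n := natDegree_add_le_of_degree_le hp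
    ((natDegree_C_mul_le τ q).trans (natDegree_le_of_degree_le (Order.lt_succ_iff.1 hq_deg)))
  obtain ⟨x, hx, hxE⟩ := hbest _ hdeg
  refine hxE.not_gt ?_
  simpa [e, sub_sub] using hτ ⟨x, hx⟩

-- The midpoint of two best approximations is best, and where its error is extremal the two agree.
theorem eq_of_forall_exists_le {q : ℝ[X]} (hK : IsCompact K) (hf : ContinuousOn f K) (hE : 0 < E)
    (hp : p.natDegree ≤ n) (hq : q.natDegree ≤ n) (hp_le : ∀ x ∈ K, |f x - p.eval x| ≤ E)
    (hq_le : ∀ x ∈ K, |f x - q.eval x| ≤ E)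
    (hbest : ∀ r : ℝ[X], r.natDegree ≤ n → ∃ x ∈ K, E ≤ |f x - r.eval x|) : p = q := by
  have hmid_eval : ∀ x, f x - (C (1 / 2) * (p + q)).eval x =
      ((f x - p.eval x) + (f x - q.eval x)) / 2 := fun x => by
    simp only [eval_mul, eval_C, eval_add]
    ring
  obtain ⟨z, hz⟩ := exists_alternates_of_forall_exists_le (p := C (1 / 2) * (p + q)) hK hf hE
    ((natDegree_C_mul_le _ _).trans (natDegree_add_le_of_degree_le hp hq))
    (fun x hx => by
      have hpx := abs_le.1 (hp_le x hx)
      have hqx := abs_le.1 (hq_le x hx)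
      rw [hmid_eval, abs_le]
      constructor <;> linarith) hbest
  have hroot : ∀ i, (p - q).eval (z i) = 0 := fun i => by
    have habs := hz.abs_eq hE.le i
    simp only [hmid_eval] at habs
    have hpx := abs_le.1 (hp_le _ (hz.mem i))
    have hqx := abs_le.1 (hq_le _ (hz.mem i))
    rw [eval_sub]
    rcases eq_or_eq_neg_of_abs_eq habs with heq | heq <;> linarith
  refine sub_eq_zero.1 (eq_zero_of_natDegree_lt_card_of_eval_eq_zero (p - q)
    hz.strictMono.injective hroot ?_)
  rw [Fintype.card_fin]
  exact ((natDegree_sub_le_iff_left hq).2 hp).trans_lt (by omega)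

end BestApproximation

/-- The error `x ↦ |x - α| - p x` of a polynomial `p` as an approximation to the checkmark. -/
def err (α : ℝ) (p : ℝ[X]) (x : ℝ) : ℝ := |x - α| - p.eval x

/-- The uniform norm of `err α p` on `[-1, 1]`; its minimal value is `E_n(α)`. -/
def maxErr (α : ℝ) (p : ℝ[X]) : ℝ := ‖checkmark α - p.toContinuousMapOn (Icc (-1 : ℝ) 1)‖

section Minimax

variable {n : ℕ} {α β E : ℝ} {p q : ℝ[X]}

theorem continuous_err (α : ℝ) (p : ℝ[X]) : Continuous (err α p) := by
  unfold err
  fun_prop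

theorem maxErr_le_iff : maxErr α p ≤ E ↔ ∀ x ∈ Icc (-1 : ℝ) 1, |err α p x| ≤ E := by
  have : Nonempty (Icc (-1 : ℝ) 1) := ⟨⟨0, by norm_num⟩⟩
  exact (ContinuousMap.norm_le_of_nonempty _).trans Subtype.forall

theorem abs_err_le_maxErr (α : ℝ) (p : ℝ[X]) {x : ℝ} (hx : x ∈ Icc (-1 : ℝ) 1) :
    |err α p x| ≤ maxErr α p :=
  maxErr_le_iff.1 le_rfl x hx

theorem exists_abs_err_eq_maxErr (α : ℝ) (p : ℝ[X]) :
    ∃ x ∈ Icc (-1 : ℝ) 1, |err α p x| = maxErr α p := by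
  obtain ⟨x, hx, hmax⟩ := (isCompact_Icc (a := (-1 : ℝ)) (b := 1)).exists_isMaxOn
    ⟨0, by norm_num⟩ (continuous_err α p).abs.continuousOn
  exact ⟨x, hx, (abs_err_le_maxErr α p hx).antisymm (maxErr_le_iff.2 fun y hy => hmax hy)⟩

theorem mem_degreeLE_iff : p ∈ degreeLE ℝ n ↔ p.natDegree ≤ n := by
  rw [mem_degreeLE, natDegree_le_iff_degree_le]

theorem IsMinimax.natDegree_le (hp : IsMinimax n α p) : p.natDegree ≤ n :=
  mem_degreeLE_iff.1 hp.1

theorem IsMinimax.maxErr_le (hp : IsMinimax n α p) (hq : q.natDegree ≤ n) :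
    maxErr α p ≤ maxErr α q :=
  hp.2 q (mem_degreeLE_iff.2 hq)

theorem IsMinimax.exists_le_abs_err (hp : IsMinimax n α p) (hq : q.natDegree ≤ n) :
    ∃ x ∈ Icc (-1 : ℝ) 1, maxErr α p ≤ |err α q x| := by
  obtain ⟨x, hx, hxq⟩ := exists_abs_err_eq_maxErr α q
  exact ⟨x, hx, hxq ▸ hp.maxErr_le hq⟩

theorem minimaxPoly_isMinimax (n : ℕ) (α : ℝ) : IsMinimax n α (minimaxPoly n α) :=
  (exists_isMinimax n α).choose_spec

theorem IsMinimax.unique (hp : IsMinimax n α p) (hq : IsMinimax n α q) (hpos : 0 < maxErr α p) :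
    p = q :=
  eq_of_forall_exists_le (f := fun x => |x - α|) isCompact_Icc (by fun_prop) hpos
    hp.natDegree_le hq.natDegree_le (fun _ hx => abs_err_le_maxErr α p hx)
    (fun _ hx => (abs_err_le_maxErr α q hx).trans (hq.maxErr_le hp.natDegree_le))
    fun _ hr => hp.exists_le_abs_err hr

/-- Chebyshev's certificate of optimality: the error of `p` is at most `E` on `[-1, 1]` and takes
the values `± E` alternately at `n + 2` points. -/
structure Equioscillates (n : ℕ) (α : ℝ) (p : ℝ[X]) (E : ℝ) : Prop where
  natDegree_le : p.natDegree ≤ n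
  pos : 0 < E
  abs_err_le : ∀ x ∈ Icc (-1 : ℝ) 1, |err α p x| ≤ E
  alternates : ∃ z : Fin (n + 2) → ℝ, Alternates (err α p) (Icc (-1) 1) E z

theorem IsMinimax.equioscillates (hp : IsMinimax n α p) (hpos : 0 < maxErr α p) :
    Equioscillates n α p (maxErr α p) where
  natDegree_le := hp.natDegree_le
  pos := hpos
  abs_err_le _ hx := abs_err_le_maxErr α p hx
  alternates := exists_alternates_of_forall_exists_le (f := fun x => |x - α|) isCompact_Icc
    (by fun_prop) hpos hp.natDegree_le (fun _ hx => abs_err_le_maxErr α p hx)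
    fun _ hq => hp.exists_le_abs_err hq

theorem Equioscillates.maxErr_eq (h : Equioscillates n α p E) : maxErr α p = E := by
  obtain ⟨z, hz⟩ := h.alternates
  exact (maxErr_le_iff.2 h.abs_err_le).antisymm
    ((hz.abs_eq h.pos.le 0).ge.trans (abs_err_le_maxErr α p (hz.mem 0)))

theorem Equioscillates.isMinimax (h : Equioscillates n α p E) : IsMinimax n α p := by
  obtain ⟨z, hz⟩ := h.alternates
  refine ⟨mem_degreeLE_iff.2 h.natDegree_le, fun q hq => ?_⟩
  obtain ⟨x, hx, hxq⟩ := Alternates.exists_le_abs_sub (f := fun x => |x - α|) hz h.pos.le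
    h.natDegree_le (mem_degreeLE_iff.1 hq)
  exact h.maxErr_eq.le.trans (hxq.trans (abs_err_le_maxErr α q hx))

theorem Equioscillates.minimaxPoly_eq (h : Equioscillates n α p E) : minimaxPoly n α = p :=
  (h.isMinimax.unique (minimaxPoly_isMinimax n α) (h.maxErr_eq ▸ h.pos)).symm

theorem Equioscillates.minimaxError_eq (h : Equioscillates n α p E) : minimaxError n α = E := by
  rw [minimaxError, h.minimaxPoly_eq]
  exact h.maxErr_eq

theorem minimaxError_pos (n : ℕ) (hα : α ∈ Ioo (-1 : ℝ) 1) : 0 < minimaxError n α := by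
  refine (norm_nonneg _).lt_of_ne fun h0 => ?_
  have heval : ∀ x ∈ Icc (-1 : ℝ) 1, (minimaxPoly n α).eval x = |x - α| := fun x hx =>
    (sub_eq_zero.1 (abs_nonpos_iff.1 ((abs_err_le_maxErr α _ hx).trans h0.ge))).symm
  have hright : minimaxPoly n α = X - C α := by
    refine eq_of_infinite_eval_eq _ _ ((Ioo_infinite hα.2).mono fun x hx => ?_)
    have hx' : x ∈ Icc (-1 : ℝ) 1 := ⟨by linarith [hx.1, hα.1], hx.2.le⟩
    rw [mem_ofPred_eq, heval x hx', abs_of_pos (sub_pos.2 hx.1), eval_sub, eval_X, eval_C]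
  have hleft := heval (-1) (by norm_num)
  rw [hright, abs_of_neg (by linarith [hα.1]), eval_sub, eval_X, eval_C] at hleft
  linarith [hα.1]

theorem equioscillates_minimaxPoly (n : ℕ) (hα : α ∈ Ioo (-1 : ℝ) 1) :
    Equioscillates n α (minimaxPoly n α) (minimaxError n α) :=
  (minimaxPoly_isMinimax n α).equioscillates (minimaxError_pos n hα)

theorem norm_checkmark_sub_le (α β : ℝ) : ‖checkmark α - checkmark β‖ ≤ |α - β| := by
  refine (ContinuousMap.norm_le _ (abs_nonneg _)).2 fun x => ?_
  simpa [checkmark, abs_sub_comm α] using abs_abs_sub_abs_le_abs_sub ((x : ℝ) - α) (x - β)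

theorem continuous_checkmark : Continuous checkmark := by
  refine LipschitzWith.continuous (K := 1) (LipschitzWith.of_dist_le_mul fun α β => ?_)
  simpa [dist_eq_norm] using norm_checkmark_sub_le α β

theorem continuous_minimaxError (n : ℕ) : Continuous (minimaxError n) := by
  refine LipschitzWith.continuous (K := 1) (LipschitzWith.of_le_add fun α β => ?_)
  let q := (minimaxPoly n β).toContinuousMapOn (Icc (-1 : ℝ) 1)
  calc minimaxError n α ≤ ‖checkmark α - q‖ :=
        (minimaxPoly_isMinimax n α).maxErr_le (minimaxPoly_isMinimax n β).natDegree_le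
    _ = ‖(checkmark β - q) + (checkmark α - checkmark β)‖ := by congr 1; abel
    _ ≤ minimaxError n β + dist α β :=
        (norm_add_le _ _).trans (add_le_add_right (norm_checkmark_sub_le α β) _)

end Minimax

section Symmetries

variable {n : ℕ} {α E s : ℝ} {p : ℝ[X]}

/-- The polynomial `s * p ((x + 1) / s - 1)`: the affine map `x ↦ s * (x + 1) - 1` fixes `-1` and
carries checkmarks to checkmarks, up to the factor `s`. -/
def scalePoly (s : ℝ) (p : ℝ[X]) : ℝ[X] :=
  C s * p.comp (C s⁻¹ * (X + 1) - 1)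

theorem natDegree_scalePoly_le (s : ℝ) (p : ℝ[X]) : (scalePoly s p).natDegree ≤ p.natDegree := by
  have hlin : (C s⁻¹ * (X + 1) - 1 : ℝ[X]).natDegree ≤ 1 := by compute_degree
  refine (natDegree_C_mul_le _ _).trans (natDegree_comp_le.trans ?_)
  simpa using Nat.mul_le_mul_left p.natDegree hlin

theorem err_scalePoly (hs : 0 < s) (α : ℝ) (p : ℝ[X]) (x : ℝ) :
    err (s * (α + 1) - 1) (scalePoly s p) (s * (x + 1) - 1) = s * err α p x := by
  have hsub : s * (x + 1) - 1 - (s * (α + 1) - 1) = s * (x - α) := by ring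
  have hinv : s⁻¹ * (s * (x + 1) - 1 + 1) - 1 = x := by field_simp; ring
  simp only [err, scalePoly, eval_mul, eval_C, eval_comp, eval_sub, eval_add, eval_X, eval_one]
  rw [hsub, hinv, abs_mul, abs_of_pos hs, mul_sub]

theorem Alternates.equioscillates_scalePoly {z : Fin (n + 2) → ℝ} (hs : 0 < s)
    (hz : Alternates (err α p) (Icc (-1) (2 / s - 1)) E z) (hE : 0 < E) (hp : p.natDegree ≤ n)
    (hle : ∀ x ∈ Icc (-1) (2 / s - 1), |err α p x| ≤ E) :
    Equioscillates n (s * (α + 1) - 1) (scalePoly s p) (s * E) := by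
  refine ⟨(natDegree_scalePoly_le s p).trans hp, mul_pos hs hE, fun x hx => ?_,
    fun i => s * (z i + 1) - 1, fun i j hij => ?_, fun i => ⟨?_, ?_⟩, ?_⟩
  · have hx' : s * (((x + 1) / s - 1) + 1) - 1 = x := by field_simp; ring
    have hmem : (x + 1) / s - 1 ∈ Icc (-1) (2 / s - 1) := by
      have := div_nonneg (neg_le_iff_add_nonneg.1 hx.1) hs.le
      exact ⟨by linarith, by gcongr; linarith [hx.2]⟩
    rw [← hx', err_scalePoly hs, abs_mul, abs_of_pos hs]
    exact mul_le_mul_of_nonneg_left (hle _ hmem) hs.le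
  · have := hz.strictMono hij
    gcongr
  · linarith [mul_nonneg hs.le (neg_le_iff_add_nonneg.1 (hz.mem i).1)]
  · have := (le_div_iff₀' hs).1 (le_sub_iff_add_le.1 (hz.mem i).2)
    linarith
  · obtain ⟨ε, hε, hsign⟩ := hz.sign
    exact ⟨ε, hε, fun i => by rw [err_scalePoly hs, hsign]; ring⟩

theorem err_comp_neg (α : ℝ) (p : ℝ[X]) (x : ℝ) : err (-α) (p.comp (-X)) x = err α p (-x) := by
  simp only [err, eval_comp, eval_neg, eval_X]
  rw [← abs_neg (x - -α), neg_sub', neg_neg]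

theorem natDegree_comp_neg (p : ℝ[X]) : (p.comp (-X)).natDegree = p.natDegree := by
  simp [natDegree_comp]

theorem Equioscillates.reflect (h : Equioscillates n α p E) :
    Equioscillates n (-α) (p.comp (-X)) E := by
  obtain ⟨z, hz⟩ := h.alternates
  refine ⟨(natDegree_comp_neg p).trans_le h.natDegree_le, h.pos, fun x hx => ?_,
    fun i => -z i.rev, .of_succ_eq_neg (fun i j hij => ?_) (fun i => ?_) ?_ fun i => ?_⟩
  · rw [err_comp_neg]
    exact h.abs_err_le _ (by simpa [neg_le, and_comm] using hx)
  · exact neg_lt_neg (hz.strictMono (Fin.rev_lt_rev.2 hij))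
  · simpa [neg_le, and_comm] using hz.mem i.rev
  · rw [err_comp_neg, neg_neg]
    exact hz.abs_eq h.pos.le _
  · simp only [err_comp_neg, neg_neg, Fin.rev_succ, Fin.rev_castSucc, hz.succ_eq_neg]

theorem minimaxError_neg (n : ℕ) (α : ℝ) : minimaxError n (-α) = minimaxError n α := by
  have hle : ∀ β, minimaxError n (-β) ≤ minimaxError n β := fun β => by
    refine ((minimaxPoly_isMinimax n (-β)).maxErr_le ((natDegree_comp_neg _).trans_le
      (minimaxPoly_isMinimax n β).natDegree_le)).trans (maxErr_le_iff.2 fun x hx => ?_)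
    rw [err_comp_neg]
    exact abs_err_le_maxErr _ _ (by simpa [neg_le, and_comm] using hx)
  exact (hle α).antisymm (by simpa using hle (-α))

end Symmetries

section Counting

theorem notMem_Ioo_castSucc_succ {β : Type*} [LinearOrder β] {N : ℕ} {z : Fin (N + 1) → β}
    (hz : StrictMono z) (i : Fin N) (k : Fin (N + 1)) : z k ∉ Ioo (z i.castSucc) (z i.succ) :=
  fun h => (Fin.castSucc_lt_iff_succ_le.1 (hz.lt_iff_lt.1 h.1)).not_gt (hz.lt_iff_lt.1 h.2)

theorem exists_derivative_roots_between {g : ℝ[X]} {c : ℝ} {S : Finset ℝ}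
    (hg : ∀ x ∈ S, g.eval x = c) :
    ∃ Z : Finset ℝ, S.card ≤ Z.card + 1 ∧ ∀ w ∈ Z, g.derivative.eval w = 0 ∧ w ∉ S ∧
      (∃ x ∈ S, x < w) ∧ ∃ y ∈ S, w < y := by
  obtain hS | ⟨k, hS⟩ : S.card = 0 ∨ ∃ k, S.card = k + 1 := by cases S.card <;> simp
  · exact ⟨∅, by simp [hS], by simp⟩
  let s := S.orderEmbOfFin hS
  have hs : ∀ i, s i ∈ S := S.orderEmbOfFin_mem hS
  have hrolle : ∀ i : Fin k, ∃ w ∈ Ioo (s i.castSucc) (s i.succ), g.derivative.eval w = 0 :=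
    fun i => exists_hasDerivAt_eq_zero (s.strictMono Fin.castSucc_lt_succ)
      g.continuous.continuousOn ((hg _ (hs _)).trans (hg _ (hs _)).symm) fun x _ => g.hasDerivAt x
  choose w hw hw0 using hrolle
  have hwmono : StrictMono w := fun i j hij =>
    ((hw i).2.trans_le (s.monotone (Fin.succ_le_castSucc_iff.2 hij))).trans (hw j).1
  refine ⟨Finset.univ.map ⟨w, hwmono.injective⟩, by simp [hS], fun v hv => ?_⟩
  obtain ⟨i, -, rfl⟩ := Finset.mem_map.1 hv
  refine ⟨hw0 i, fun hmem => ?_, ⟨_, hs _, (hw i).1⟩, _, hs _, (hw i).2⟩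
  obtain ⟨m, hm⟩ : w i ∈ range s := (S.range_orderEmbOfFin hS).symm ▸ hmem
  exact notMem_Ioo_castSucc_succ s.strictMono i m (hm ▸ hw i)

theorem card_add_natDegree_le_of_dvd {f d : ℝ[X]} (hf : f ≠ 0) (hd : d ∣ f) {Z : Finset ℝ}
    (hZ : ∀ w ∈ Z, f.eval w = 0 ∧ d.eval w ≠ 0) : Z.card + d.natDegree ≤ f.natDegree := by
  obtain ⟨r, rfl⟩ := hd
  have hr : r ≠ 0 := right_ne_zero_of_mul hf
  rw [natDegree_mul (left_ne_zero_of_mul hf) hr, add_comm]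
  refine Nat.add_le_add_left (card_le_degree_of_subset_roots fun w hw => ?_) _
  obtain ⟨hfw, hdw⟩ := hZ w hw
  exact (mem_roots hr).2 ((mul_eq_zero.1 (eval_mul.symm.trans hfw)).resolve_left hdw)

variable {n : ℕ} {g : ℝ[X]} {c c' : ℝ} {S T : Finset ℝ}

theorem card_le_natDegree_derivative_add_one (hg : g.derivative ≠ 0)
    (hS : ∀ x ∈ S, g.eval x = c) : S.card ≤ g.derivative.natDegree + 1 := by
  obtain ⟨Z, hZ, hroot⟩ := exists_derivative_roots_between hS
  have := card_le_degree_of_subset_roots (Z := Z) fun w hw => (mem_roots hg).2 (hroot w hw).1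
  omega

-- Rolle's theorem on `S` and on `T` gives simple zeros of `g'` away from those of `d`.
theorem card_add_card_add_natDegree_le {d : ℝ[X]} (hg : g.derivative ≠ 0)
    (hST : ∀ x ∈ S, ∀ y ∈ T, x < y) (hS : ∀ x ∈ S, g.eval x = c) (hT : ∀ y ∈ T, g.eval y = c')
    (hd : d ∣ g.derivative)
    (hdroot : ∀ w, d.eval w = 0 → w ∈ S ∨ w ∈ T ∨ (∀ x ∈ S, x ≤ w) ∧ ∀ y ∈ T, w ≤ y) :
    S.card + T.card + d.natDegree ≤ g.derivative.natDegree + 2 := by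
  obtain ⟨Z, hZ, hZroot⟩ := exists_derivative_roots_between hS
  obtain ⟨W, hW, hWroot⟩ := exists_derivative_roots_between hT
  have hdisj : Disjoint Z W := Finset.disjoint_left.2 fun w hwZ hwW => by
    obtain ⟨-, -, -, x, hx, hwx⟩ := hZroot w hwZ
    obtain ⟨-, -, ⟨y, hy, hyw⟩, -⟩ := hWroot w hwW
    exact lt_asymm (hyw.trans hwx) (hST x hx y hy)
  have hcount := card_add_natDegree_le_of_dvd (Z := Z ∪ W) hg hd fun w hw => by
    rcases Finset.mem_union.1 hw with hw | hw
    · obtain ⟨h0, hwS, -, x, hx, hwx⟩ := hZroot w hw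
      refine ⟨h0, fun hdw => ?_⟩
      rcases hdroot w hdw with h | h | h
      · exact hwS h
      · exact lt_asymm hwx (hST x hx w h)
      · exact (h.1 x hx).not_gt hwx
    · obtain ⟨h0, hwT, ⟨y, hy, hyw⟩, -⟩ := hWroot w hw
      refine ⟨h0, fun hdw => ?_⟩
      rcases hdroot w hdw with h | h | h
      · exact lt_asymm hyw (hST w h y hy)
      · exact hwT h
      · exact (h.2 y hy).not_gt hyw
  rw [Finset.card_union_of_disjoint hdisj] at hcount
  omega

theorem nonempty_and_nonempty_of_le_card (hg : g.derivative ≠ 0)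
    (hdeg : g.derivative.natDegree + 2 ≤ n) (hS : ∀ x ∈ S, g.eval x = c)
    (hT : ∀ y ∈ T, g.eval y = c') (hcard : n ≤ S.card + T.card) : S.Nonempty ∧ T.Nonempty := by
  have hScard := card_le_natDegree_derivative_add_one hg hS
  have hTcard := card_le_natDegree_derivative_add_one hg hT
  constructor <;> refine Finset.card_pos.1 ?_ <;> omega

theorem derivative_pos_of_le_card (hg : g.derivative ≠ 0) (hdeg : g.derivative.natDegree + 2 ≤ n)
    (hcc : c < c') (hST : ∀ x ∈ S, ∀ y ∈ T, x < y) (hS : ∀ x ∈ S, g.eval x = c)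
    (hT : ∀ y ∈ T, g.eval y = c') (hcard : n ≤ S.card + T.card) {w : ℝ} (hSw : ∀ x ∈ S, x ≤ w)
    (hTw : ∀ y ∈ T, w ≤ y) : 0 < g.derivative.eval w := by
  obtain ⟨hSne, hTne⟩ := nonempty_and_nonempty_of_le_card hg hdeg hS hT hcard
  have hne : ∀ v ∈ Icc (S.max' hSne) (T.min' hTne), g.derivative.eval v ≠ 0 := fun v hv h0 => by
    have := card_add_card_add_natDegree_le hg hST hS hT (dvd_iff_isRoot.2 h0) fun u hu => by
      rw [eval_sub, eval_X, eval_C, sub_eq_zero] at hu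
      subst hu
      exact Or.inr (Or.inr ⟨fun x hx => (S.le_max' x hx).trans hv.1,
        fun y hy => hv.2.trans (T.min'_le y hy)⟩)
    rw [natDegree_X_sub_C] at this
    omega
  have hlt := hST _ (S.max'_mem hSne) _ (T.min'_mem hTne)
  obtain ⟨v, hv, hslope⟩ := exists_hasDerivAt_eq_slope (fun x => g.eval x) _ hlt
    g.continuous.continuousOn fun x _ => g.hasDerivAt x
  have hvpos : 0 < g.derivative.eval v := by
    rw [hslope, hS _ (S.max'_mem hSne), hT _ (T.min'_mem hTne)]
    exact div_pos (sub_pos.2 hcc) (sub_pos.2 hlt)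
  have hw : w ∈ Icc (S.max' hSne) (T.min' hTne) := ⟨S.max'_le _ _ hSw, T.le_min' _ _ hTw⟩
  by_contra hneg
  obtain ⟨u, hu, hu0⟩ := intermediate_value_uIcc
    (g.derivative.continuous.continuousOn (s := uIcc w v))
    (mem_uIcc.2 (Or.inl ⟨not_lt.1 hneg, hvpos.le⟩))
  exact hne u (ordConnected_Icc.uIcc_subset hw (Ioo_subset_Icc_self hv) hu) hu0

theorem natDegree_derivative_derivative_add_two_le {p : ℝ[X]} (hp : p.natDegree ≤ n)
    (h : p.derivative.derivative ≠ 0) : p.derivative.derivative.natDegree + 2 ≤ n := by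
  have hle := natDegree_derivative_le p
  have hle' := natDegree_derivative_le p.derivative
  have hne : p.derivative.natDegree ≠ 0 := fun h0 => h (derivative_of_natDegree_zero h0)
  omega

theorem strictMonoOn_eval_of_derivative_pos {s : Set ℝ} (hs : Convex ℝ s)
    (h : ∀ x ∈ interior s, 0 < g.derivative.eval x) : StrictMonoOn (fun x => g.eval x) s :=
  strictMonoOn_of_deriv_pos hs g.continuous.continuousOn fun x hx => by
    rw [Polynomial.deriv]
    exact h x hx

end Counting

section CriticalPoints

variable {n N : ℕ} {α E c x y : ℝ} {p d : ℝ[X]}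

/-- The critical points of the error, other than the corner. -/
def IsCrit (α : ℝ) (p : ℝ[X]) (x : ℝ) : Prop :=
  (x < α ∧ p.derivative.eval x = -1) ∨ (α < x ∧ p.derivative.eval x = 1)

theorem err_of_le (p : ℝ[X]) (h : x ≤ α) : err α p x = (C α - X - p).eval x := by
  simp [err, abs_of_nonpos (sub_nonpos.2 h)]

theorem err_of_ge (p : ℝ[X]) (h : α ≤ x) : err α p x = (X - C α - p).eval x := by
  simp [err, abs_of_nonneg (sub_nonneg.2 h)]

theorem hasDerivAt_err_left (p : ℝ[X]) (h : x < α) :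
    HasDerivAt (err α p) (-1 - p.derivative.eval x) x :=
  ((hasDerivAt_abs_neg (sub_neg.2 h)).comp_sub_const x α).sub (p.hasDerivAt x)

theorem hasDerivAt_err_right (p : ℝ[X]) (h : α < x) :
    HasDerivAt (err α p) (1 - p.derivative.eval x) x :=
  ((hasDerivAt_abs_pos (sub_pos.2 h)).comp_sub_const x α).sub (p.hasDerivAt x)

theorem strictAntiOn_err_left {a b : ℝ} (hb : b ≤ α)
    (h : ∀ x ∈ Ioo a b, -1 < p.derivative.eval x) : StrictAntiOn (err α p) (Icc a b) := by
  refine strictAntiOn_of_deriv_neg (convex_Icc a b) (continuous_err α p).continuousOn fun x hx => ?_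
  rw [interior_Icc] at hx
  rw [(hasDerivAt_err_left p (hx.2.trans_le hb)).deriv]
  linarith [h x hx]

theorem strictMonoOn_err_right {a b : ℝ} (ha : α ≤ a)
    (h : ∀ x ∈ Ioo a b, p.derivative.eval x < 1) : StrictMonoOn (err α p) (Icc a b) := by
  refine strictMonoOn_of_deriv_pos (convex_Icc a b) (continuous_err α p).continuousOn fun x hx => ?_
  rw [interior_Icc] at hx
  rw [(hasDerivAt_err_right p (ha.trans_lt hx.1)).deriv]
  linarith [h x hx]

theorem strictAntiOn_err_right {a b : ℝ} (ha : α ≤ a)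
    (h : ∀ x ∈ Ioo a b, 1 < p.derivative.eval x) : StrictAntiOn (err α p) (Icc a b) := by
  refine strictAntiOn_of_deriv_neg (convex_Icc a b) (continuous_err α p).continuousOn fun x hx => ?_
  rw [interior_Icc] at hx
  rw [(hasDerivAt_err_right p (ha.trans_lt hx.1)).deriv]
  linarith [h x hx]

theorem exists_isCrit_between (hxy : x < y) (hside : y ≤ α ∨ α ≤ x)
    (he : err α p x = err α p y) : ∃ w ∈ Ioo x y, IsCrit α p w := by
  have hcont : ContinuousOn (err α p) (Icc x y) := (continuous_err α p).continuousOn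
  rcases hside with hy | hx
  · obtain ⟨w, hw, hw0⟩ := exists_hasDerivAt_eq_zero hxy hcont he
      fun v hv => hasDerivAt_err_left p (hv.2.trans_le hy)
    exact ⟨w, hw, Or.inl ⟨hw.2.trans_le hy, by linarith⟩⟩
  · obtain ⟨w, hw, hw0⟩ := exists_hasDerivAt_eq_zero hxy hcont he
      fun v hv => hasDerivAt_err_right p (hx.trans_lt hv.1)
    exact ⟨w, hw, Or.inr ⟨hx.trans_lt hw.1, by linarith⟩⟩

theorem isLocalExtr_of_abs_eq {e : ℝ → ℝ} (hle : ∀ᶠ y in 𝓝 x, |e y| ≤ E) (hx : |e x| = E) :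
    IsLocalExtr e x := by
  rcases abs_choice (e x) with h | h
  · right
    filter_upwards [hle] with y hy
    linarith [(abs_le.1 hy).2]
  · left
    filter_upwards [hle] with y hy
    linarith [(abs_le.1 hy).1]

theorem Equioscillates.isLocalExtr (h : Equioscillates n α p E) (hx : x ∈ Ioo (-1 : ℝ) 1)
    (hxE : |err α p x| = E) : IsLocalExtr (err α p) x :=
  isLocalExtr_of_abs_eq (by filter_upwards [Icc_mem_nhds hx.1 hx.2] with y using h.abs_err_le y) hxE

theorem Equioscillates.isCrit (h : Equioscillates n α p E) (hx : x ∈ Ioo (-1 : ℝ) 1) (hxα : x ≠ α)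
    (hxE : |err α p x| = E) : IsCrit α p x := by
  have hextr := h.isLocalExtr hx hxE
  rcases hxα.lt_or_gt with hlt | hlt
  · exact Or.inl ⟨hlt, by linarith [hextr.hasDerivAt_eq_zero (hasDerivAt_err_left p hlt)]⟩
  · exact Or.inr ⟨hlt, by linarith [hextr.hasDerivAt_eq_zero (hasDerivAt_err_right p hlt)]⟩

theorem derivative_comp_neg (p : ℝ[X]) :
    (p.comp (-X)).derivative = -p.derivative.comp (-X) := by
  simp [derivative_comp]

theorem isCrit_comp_neg : IsCrit (-α) (p.comp (-X)) x ↔ IsCrit α p (-x) := by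
  simp only [IsCrit, derivative_comp_neg, eval_neg, eval_comp, eval_X, neg_eq_iff_eq_neg, neg_neg,
    lt_neg, neg_lt]
  exact or_comm

theorem Alternates.not_antitone {e : ℝ → ℝ} {K : Set ℝ} {z : Fin (N + 3) → ℝ}
    (hz : Alternates e K E z) (hE : 0 < E) : ¬ Antitone e := fun hanti => by
  have h01 := hz.succ_eq_neg 0
  have h12 := hz.succ_eq_neg 1
  have hle := hanti (hz.strictMono (Fin.castSucc_lt_succ (i := (0 : Fin (N + 2))))).le
  have hle' := hanti (hz.strictMono (Fin.castSucc_lt_succ (i := (1 : Fin (N + 2))))).le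
  have habs := hz.abs_eq hE.le (1 : Fin (N + 2)).castSucc
  have h1 : (0 : Fin (N + 2)).succ = (1 : Fin (N + 2)).castSucc := rfl
  rw [h1] at h01 hle
  rw [_root_.abs_eq hE.le] at habs
  rcases habs with habs | habs <;> linarith

theorem Equioscillates.derivative_ne_one (h : Equioscillates n α p E) : p.derivative ≠ 1 := by
  intro hp
  obtain ⟨z, hz⟩ := h.alternates
  obtain _ | m := n
  · exact one_ne_zero (hp.symm.trans (derivative_of_natDegree_zero (Nat.le_zero.1 h.natDegree_le)))
  have hconst : p - X = C ((p - X).coeff 0) :=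
    eq_C_of_natDegree_eq_zero (derivative_eq_zero.1 (by simp [hp]))
  refine hz.not_antitone h.pos fun x y hxy => ?_
  rw [sub_eq_iff_eq_add] at hconst
  simp only [err]
  rw [hconst]
  simp only [eval_add, eval_C, eval_X]
  linarith [abs_sub_abs_le_abs_sub (y - α) (x - α), abs_of_nonneg (sub_nonneg.2 hxy),
    sub_sub_sub_cancel_right y x α ▸ abs_sub_abs_le_abs_sub (y - α) (x - α)]

theorem Equioscillates.derivative_ne_neg_one (h : Equioscillates n α p E) :
    p.derivative ≠ -1 := fun hp =>
  h.reflect.derivative_ne_one (by rw [derivative_comp_neg, hp]; simp)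

theorem Equioscillates.derivative_derivative_ne_zero (h : Equioscillates n α p E)
    (hx : p.derivative.eval x = 1 ∨ p.derivative.eval x = -1) : p.derivative.derivative ≠ 0 := by
  intro h0
  have hconst := eq_C_of_natDegree_eq_zero (derivative_eq_zero.1 h0)
  rw [hconst, eval_C] at hx
  rcases hx with hx | hx <;> rw [hx] at hconst
  · exact h.derivative_ne_one (by simpa using hconst)
  · exact h.derivative_ne_neg_one (by simpa using hconst)

open Classical in
/-- The critical points to the left of the corner. -/
def critLeft (α : ℝ) (p : ℝ[X]) : Finset ℝ :=
  {x ∈ (p.derivative + 1).roots.toFinset | x < α}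

open Classical in
/-- The critical points to the right of the corner. -/
def critRight (α : ℝ) (p : ℝ[X]) : Finset ℝ :=
  {x ∈ (p.derivative - 1).roots.toFinset | α < x}

open Classical in
/-- All critical points of the error on the real line, other than the corner. -/
def crit (α : ℝ) (p : ℝ[X]) : Finset ℝ := critLeft α p ∪ critRight α p

theorem Equioscillates.mem_critLeft (h : Equioscillates n α p E) :
    x ∈ critLeft α p ↔ x < α ∧ p.derivative.eval x = -1 := by
  have hne : p.derivative + 1 ≠ 0 := fun h0 =>
    h.derivative_ne_neg_one (eq_neg_of_add_eq_zero_left h0)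
  simp only [critLeft, Finset.mem_filter, Multiset.mem_toFinset, mem_roots hne, IsRoot, eval_add,
    eval_one, add_eq_zero_iff_eq_neg, and_comm]

theorem Equioscillates.mem_critRight (h : Equioscillates n α p E) :
    x ∈ critRight α p ↔ α < x ∧ p.derivative.eval x = 1 := by
  have hne : p.derivative - 1 ≠ 0 := sub_ne_zero.2 h.derivative_ne_one
  simp only [critRight, Finset.mem_filter, Multiset.mem_toFinset, mem_roots hne, IsRoot, eval_sub,
    eval_one, sub_eq_zero, and_comm]

theorem Equioscillates.mem_crit (h : Equioscillates n α p E) : x ∈ crit α p ↔ IsCrit α p x := by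
  rw [crit, Finset.mem_union, h.mem_critLeft, h.mem_critRight, IsCrit]

theorem Equioscillates.lt_of_mem_crit (h : Equioscillates n α p E) (hx : x ∈ critLeft α p)
    (hy : y ∈ critRight α p) : x < y :=
  (h.mem_critLeft.1 hx).1.trans (h.mem_critRight.1 hy).1

theorem Equioscillates.card_crit (h : Equioscillates n α p E) :
    (crit α p).card = (critLeft α p).card + (critRight α p).card :=
  Finset.card_union_of_disjoint (Finset.disjoint_left.2 fun _ hl hr =>
    lt_irrefl _ (h.lt_of_mem_crit hl hr))

theorem Equioscillates.crit_comp_neg (h : Equioscillates n α p E) :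
    crit (-α) (p.comp (-X)) = (crit α p).map (Equiv.neg ℝ).toEmbedding := by
  ext x
  rw [h.reflect.mem_crit, isCrit_comp_neg, ← h.mem_crit, Finset.mem_map_equiv]
  simp

theorem Equioscillates.natDegree_derivative_derivative_add_two_le (h : Equioscillates n α p E)
    (hx : x ∈ crit α p) :
    p.derivative.derivative ≠ 0 ∧ p.derivative.derivative.natDegree + 2 ≤ n := by
  have hne : p.derivative.derivative ≠ 0 :=
    h.derivative_derivative_ne_zero ((h.mem_crit.1 hx).symm.imp And.right And.right)
  exact ⟨hne, Checkmark.natDegree_derivative_derivative_add_two_le h.natDegree_le hne⟩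

theorem Equioscillates.card_crit_add_natDegree_le (h : Equioscillates n α p E)
    (hx : x ∈ crit α p) (hd : d ∣ p.derivative.derivative)
    (hdroot : ∀ w, d.eval w = 0 → w ∈ crit α p) : (crit α p).card + d.natDegree ≤ n := by
  obtain ⟨hne, hdeg⟩ := h.natDegree_derivative_derivative_add_two_le hx
  have := card_add_card_add_natDegree_le hne (fun x hx y hy => h.lt_of_mem_crit hx hy)
    (fun x hx => (h.mem_critLeft.1 hx).2) (fun x hx => (h.mem_critRight.1 hx).2) hd
    fun w hw => (Finset.mem_union.1 (hdroot w hw)).imp_right Or.inl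
  rw [h.card_crit]
  omega

theorem Equioscillates.card_crit_le (h : Equioscillates n α p E) : (crit α p).card ≤ n := by
  rcases (crit α p).eq_empty_or_nonempty with hempty | ⟨x, hx⟩
  · simp [hempty]
  · simpa using h.card_crit_add_natDegree_le hx (one_dvd _) (by simp)

end CriticalPoints

section Extremal

variable {n N : ℕ} {α E c x : ℝ} {p : ℝ[X]}

theorem Alternates.le_or_succ_le {e : ℝ → ℝ} {K : Set ℝ} {z : Fin (N + 1) → ℝ}
    (hz : Alternates e K E z) (hE : 0 ≤ E) (hx : |e x| ≤ E) (i : Fin N) :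
    e (z i.castSucc) ≤ e x ∨ e (z i.succ) ≤ e x := by
  have hx' := (abs_le.1 hx).1
  have hsucc := hz.succ_eq_neg i
  rcases eq_or_eq_neg_of_abs_eq (hz.abs_eq hE i.castSucc) with hi | hi
  · exact Or.inr (by linarith)
  · exact Or.inl (by linarith)

theorem Alternates.mem_Ioo {e : ℝ → ℝ} {z : Fin (n + 2) → ℝ}
    (hz : Alternates e (Icc (-1) 1) E z) (j : Fin n) : z j.succ.castSucc ∈ Ioo (-1 : ℝ) 1 := by
  refine ⟨(hz.mem 0).1.trans_lt (hz.strictMono ?_),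
    (hz.strictMono (Fin.castSucc_lt_last j.succ)).trans_le (hz.mem _).2⟩
  exact Fin.succ_pos j.castSucc

theorem exists_castSucc_lt_lt_succ {z : Fin (N + 1) → ℝ} (h0 : z 0 < α)
    (hlast : α < z (Fin.last N)) (hne : ∀ i, z i ≠ α) :
    ∃ i : Fin N, z i.castSucc < α ∧ α < z i.succ := by
  by_contra! hstep
  exact hlast.not_gt (Fin.induction (motive := fun i => z i < α) h0
    (fun i hi => (hstep i hi).lt_of_ne (hne _)) (Fin.last N))

theorem Equioscillates.nonempty_critLeft_and_critRight (h : Equioscillates n α p E) (hn : n ≠ 0)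
    (hcard : n ≤ (crit α p).card) : (critLeft α p).Nonempty ∧ (critRight α p).Nonempty := by
  obtain ⟨x, hx⟩ := Finset.card_pos.1 ((Nat.pos_of_ne_zero hn).trans_le hcard)
  obtain ⟨hg, hdeg⟩ := h.natDegree_derivative_derivative_add_two_le hx
  exact nonempty_and_nonempty_of_le_card hg hdeg (fun x hx => (h.mem_critLeft.1 hx).2)
    (fun x hx => (h.mem_critRight.1 hx).2) (hcard.trans_eq h.card_crit)

theorem Equioscillates.derivative_mem_Ioo (h : Equioscillates n α p E)
    (hcard : n ≤ (crit α p).card) (hL : ∀ y ∈ critLeft α p, y < x)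
    (hR : ∀ y ∈ critRight α p, x < y) : p.derivative.eval x ∈ Ioo (-1 : ℝ) 1 := by
  rcases eq_or_ne n 0 with rfl | hn
  · simp [derivative_of_natDegree_zero (Nat.le_zero.1 h.natDegree_le)]
  obtain ⟨hLne, hRne⟩ := h.nonempty_critLeft_and_critRight hn hcard
  have hmaxL := (critLeft α p).max'_mem hLne
  have hminR := (critRight α p).min'_mem hRne
  obtain ⟨hg, hdeg⟩ :=
    h.natDegree_derivative_derivative_add_two_le (Finset.mem_union_left _ hmaxL)
  have hmono : StrictMonoOn (fun x => p.derivative.eval x)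
      (Icc ((critLeft α p).max' hLne) ((critRight α p).min' hRne)) := by
    refine strictMonoOn_eval_of_derivative_pos (convex_Icc _ _) fun w hw => ?_
    have hw' := interior_subset hw
    exact derivative_pos_of_le_card hg hdeg (by norm_num) (fun x hx y hy => h.lt_of_mem_crit hx hy)
      (fun x hx => (h.mem_critLeft.1 hx).2) (fun x hx => (h.mem_critRight.1 hx).2)
      (hcard.trans_eq h.card_crit) (fun x hx => (Finset.le_max' _ x hx).trans hw'.1)
      fun y hy => hw'.2.trans (Finset.min'_le _ y hy)
  have hlt := hL _ hmaxL
  have hlt' := hR _ hminR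
  constructor
  · rw [← (h.mem_critLeft.1 hmaxL).2]
    exact hmono ⟨le_rfl, (hlt.trans hlt').le⟩ ⟨hlt.le, hlt'.le⟩ hlt
  · rw [← (h.mem_critRight.1 hminR).2]
    exact hmono ⟨hlt.le, hlt'.le⟩ ⟨(hlt.trans hlt').le, le_rfl⟩ hlt'

theorem Equioscillates.err_corner_lt (h : Equioscillates n α p E) (hcard : n ≤ (crit α p).card)
    (hx : x ≠ α) (hgap : ∀ y ∈ crit α p, y ∉ Ioo x α ∧ y ∉ Ioo α x) : err α p α < err α p x := by
  rcases hx.lt_or_gt with hlt | hlt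
  · refine strictAntiOn_err_left le_rfl (fun w hw => ?_) (left_mem_Icc.2 hlt.le)
      (right_mem_Icc.2 hlt.le) hlt
    refine (h.derivative_mem_Ioo hcard (fun y hy => ?_) fun y hy => ?_).1
    · have hy' := (hgap y (Finset.mem_union_left _ hy)).1
      by_contra! hwy
      exact hy' ⟨hw.1.trans_le hwy, (h.mem_critLeft.1 hy).1⟩
    · exact hw.2.trans (h.mem_critRight.1 hy).1
  · refine strictMonoOn_err_right le_rfl (fun w hw => ?_) (left_mem_Icc.2 hlt.le)
      (right_mem_Icc.2 hlt.le) hlt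
    refine (h.derivative_mem_Ioo hcard (fun y hy => ?_) fun y hy => ?_).2
    · exact (h.mem_critLeft.1 hy).1.trans hw.1
    · have hy' := (hgap y (Finset.mem_union_right _ hy)).2
      by_contra! hyw
      exact hy' ⟨(h.mem_critRight.1 hy).1, hyw.trans_lt hw.2⟩

theorem Alternates.card_image_interior {e : ℝ → ℝ} {K : Set ℝ} {z : Fin (n + 2) → ℝ}
    (hz : Alternates e K E z) :
    (Finset.univ.image fun j : Fin n => z j.succ.castSucc).card = n := by
  rw [Finset.card_image_of_injective _ fun i j hij => by simpa using hz.strictMono.injective hij]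
  simp

theorem Equioscillates.image_interior_eq_crit (h : Equioscillates n α p E)
    {z : Fin (n + 2) → ℝ} (hz : Alternates (err α p) (Icc (-1) 1) E z) (hne : ∀ i, z i ≠ α) :
    Finset.univ.image (fun j : Fin n => z j.succ.castSucc) = crit α p :=
  Finset.eq_of_subset_of_card_le (Finset.image_subset_iff.2 fun j _ =>
    h.mem_crit.2 (h.isCrit (hz.mem_Ioo j) (hne _) (hz.abs_eq h.pos.le _)))
    (h.card_crit_le.trans_eq hz.card_image_interior.symm)

-- If `z` misses the corner then its interior points are all the critical points, so the error
-- at the corner is strictly smaller than at both neighbouring points of `z`.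
theorem Equioscillates.exists_eq_corner (h : Equioscillates n α p E) (hα : α ∈ Icc (-1 : ℝ) 1)
    {z : Fin (n + 2) → ℝ} (hz : Alternates (err α p) (Icc (-1) 1) E z) : ∃ i, z i = α := by
  by_contra! hne
  have hcrit := h.image_interior_eq_crit hz hne
  have hcrit_eq : ∀ y ∈ crit α p, ∃ j : Fin n, z j.succ.castSucc = y := by simp [← hcrit]
  have hcard : n ≤ (crit α p).card := (hcrit ▸ hz.card_image_interior).ge
  obtain ⟨i, hlt, hlt'⟩ : ∃ i : Fin (n + 1), err α p α < err α p (z i.castSucc) ∧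
      err α p α < err α p (z i.succ) := by
    rcases eq_or_ne n 0 with rfl | hn
    · exact ⟨0, h.err_corner_lt hcard (hne _) (by simp [← hcrit]),
        h.err_corner_lt hcard (hne _) (by simp [← hcrit])⟩
    obtain ⟨⟨a, ha⟩, b, hb⟩ := h.nonempty_critLeft_and_critRight hn hcard
    obtain ⟨j, rfl⟩ := hcrit_eq a (Finset.mem_union_left _ ha)
    obtain ⟨k, rfl⟩ := hcrit_eq b (Finset.mem_union_right _ hb)
    obtain ⟨i, hi, hi'⟩ := exists_castSucc_lt_lt_succ
      ((hz.strictMono.monotone (Fin.zero_le _)).trans_lt (h.mem_critLeft.1 ha).1)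
      ((h.mem_critRight.1 hb).1.trans_le (hz.strictMono.monotone (Fin.le_last _))) hne
    have hgap : ∀ y ∈ crit α p, y ∉ Ioo (z i.castSucc) (z i.succ) := fun y hy => by
      obtain ⟨l, rfl⟩ := hcrit_eq y hy
      exact notMem_Ioo_castSucc_succ hz.strictMono i _
    exact ⟨i,
      h.err_corner_lt hcard (hne _) fun y hy =>
        ⟨fun hyI => hgap y hy ⟨hyI.1, hyI.2.trans hi'⟩, fun hyI => hi.not_gt (hyI.1.trans hyI.2)⟩,
      h.err_corner_lt hcard (hne _) fun y hy =>
        ⟨fun hyI => hi'.not_gt (hyI.1.trans hyI.2), fun hyI => hgap y hy ⟨hi.trans hyI.1, hyI.2⟩⟩⟩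
  rcases hz.le_or_succ_le h.pos.le (h.abs_err_le α hα) i with hle | hle
  · exact hlt.not_ge hle
  · exact hlt'.not_ge hle

open Classical in
/-- The points of `[-1, 1]` at which the error has modulus `E`, collected from the corner, the
endpoints and the critical points; `Equioscillates.mem_extr` says that none is missed. -/
def extr (α : ℝ) (p : ℝ[X]) (E : ℝ) : Finset ℝ :=
  {x ∈ insert α (insert (-1) (insert 1 (crit α p))) | x ∈ Icc (-1 : ℝ) 1 ∧ |err α p x| = E}

theorem Equioscillates.mem_extr (h : Equioscillates n α p E) :
    x ∈ extr α p E ↔ x ∈ Icc (-1 : ℝ) 1 ∧ |err α p x| = E := by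
  rw [extr, Finset.mem_filter, and_iff_right_iff_imp]
  rintro ⟨hx, hxE⟩
  simp only [Finset.mem_insert, or_iff_not_imp_left]
  exact fun hxα hx1 hx1' => h.mem_crit.2
    (h.isCrit ⟨hx.1.lt_of_ne' hx1, hx.2.lt_of_ne hx1'⟩ hxα hxE)

theorem Equioscillates.alternates_mem_extr (h : Equioscillates n α p E) {z : Fin N → ℝ}
    (hz : Alternates (err α p) (Icc (-1) 1) E z) (i : Fin N) : z i ∈ extr α p E :=
  h.mem_extr.2 ⟨hz.mem i, hz.abs_eq h.pos.le i⟩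

theorem Equioscillates.corner_mem_extr (h : Equioscillates n α p E) (hα : α ∈ Icc (-1 : ℝ) 1) :
    α ∈ extr α p E := by
  obtain ⟨z, hz⟩ := h.alternates
  obtain ⟨i, rfl⟩ := h.exists_eq_corner hα hz
  exact h.alternates_mem_extr hz i

theorem Equioscillates.le_card_extr (h : Equioscillates n α p E) :
    n + 2 ≤ (extr α p E).card := by
  obtain ⟨z, hz⟩ := h.alternates
  simpa using Finset.card_le_card_of_injOn z (s := Finset.univ)
    (fun i _ => h.alternates_mem_extr hz i) hz.strictMono.injective.injOn

theorem extr_subset (α E : ℝ) (p : ℝ[X]) :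
    extr α p E ⊆ insert α (insert (-1) (insert 1 (crit α p))) := by
  unfold extr
  exact Finset.filter_subset _ _

theorem card_insert_insert_insert_le {β : Type*} [DecidableEq β] (a b c : β) (s : Finset β) :
    (insert a (insert b (insert c s))).card ≤ s.card + 3 :=
  (Finset.card_insert_le _ _).trans (Nat.succ_le_succ
    ((Finset.card_insert_le _ _).trans (Nat.succ_le_succ (Finset.card_insert_le _ _))))

theorem card_extr_le_card_crit_add_three (α E : ℝ) (p : ℝ[X]) :
    (extr α p E).card ≤ (crit α p).card + 3 :=
  (Finset.card_le_card (extr_subset α E p)).trans (card_insert_insert_insert_le _ _ _ _)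

theorem Equioscillates.card_extr_le (h : Equioscillates n α p E) : (extr α p E).card ≤ n + 3 :=
  (card_extr_le_card_crit_add_three α E p).trans (Nat.add_le_add_right h.card_crit_le 3)

-- Equal values at consecutive extremal points would force a critical point between them.
theorem Equioscillates.alternates_orderEmb (h : Equioscillates n α p E) (hα : α ∈ Icc (-1 : ℝ) 1)
    (hcrit : crit α p ⊆ extr α p E) (hN : (extr α p E).card = N + 1) :
    Alternates (err α p) (Icc (-1) 1) E ((extr α p E).orderEmbOfFin hN) := by
  have hmem := fun i => h.mem_extr.1 ((extr α p E).orderEmbOfFin_mem hN i)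
  refine .of_succ_eq_neg (OrderEmbedding.strictMono _) (fun i => (hmem i).1) (hmem 0).2 fun i => ?_
  have hgap : ∀ x ∈ extr α p E, x ∉ Ioo ((extr α p E).orderEmbOfFin hN i.castSucc)
      ((extr α p E).orderEmbOfFin hN i.succ) := fun x hx => by
    obtain ⟨k, rfl⟩ := ((extr α p E).range_orderEmbOfFin hN).symm ▸ Finset.mem_coe.2 hx
    exact notMem_Ioo_castSucc_succ (OrderEmbedding.strictMono _) i k
  refine (abs_eq_abs.1 ((hmem i.succ).2.trans (hmem i.castSucc).2.symm)).resolve_left fun heq => ?_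
  have hside := not_and_or.1 (hgap α (h.corner_mem_extr hα))
  rw [not_lt, not_lt] at hside
  obtain ⟨w, hw, hwc⟩ := exists_isCrit_between (OrderEmbedding.strictMono _ Fin.castSucc_lt_succ)
    hside.symm heq.symm
  exact hgap w (hcrit (h.mem_crit.2 hwc)) hw

theorem Equioscillates.extr_comp_neg (h : Equioscillates n α p E) :
    extr (-α) (p.comp (-X)) E = (extr α p E).map (Equiv.neg ℝ).toEmbedding := by
  ext x
  rw [h.reflect.mem_extr, err_comp_neg, Finset.mem_map_equiv, Equiv.neg_symm, Equiv.neg_apply,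
    h.mem_extr, neg_mem_Icc_iff, neg_neg]

end Extremal

section Nondegeneracy

variable {n : ℕ} {α E c : ℝ} {p : ℝ[X]}

theorem eq_zero_of_isLocalExtr_cube_mul {k : ℝ → ℝ} (hk : ContinuousAt k c)
    (h : IsLocalExtr (fun x => (x - c) ^ 3 * k x) c) : k c = 0 := by
  wlog hmin : IsLocalMin (fun x => (x - c) ^ 3 * k x) c generalizing k
  · refine neg_eq_zero.1 (this (k := fun x => -k x) hk.neg ?_ ?_)
    · simpa using h.neg
    · simpa using IsLocalMax.neg (h.resolve_left hmin)
  by_contra hne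
  rcases lt_or_gt_of_ne hne with hneg | hpos
  · obtain ⟨x, ⟨hx, hkx⟩, hcx⟩ := (((hmin.and (hk.eventually_lt_const hneg)).filter_mono
      nhdsWithin_le_nhds).and (self_mem_nhdsWithin (s := Ioi c))).exists
    have := mul_neg_of_pos_of_neg (pow_pos (sub_pos.2 hcx) 3) hkx
    simp only [sub_self] at hx
    linarith
  · obtain ⟨x, ⟨hx, hkx⟩, hcx⟩ := (((hmin.and (hk.eventually_const_lt hpos)).filter_mono
      nhdsWithin_le_nhds).and (self_mem_nhdsWithin (s := Iio c))).exists
    have := mul_neg_of_neg_of_pos (Odd.pow_neg (by decide : Odd 3) (sub_neg.2 hcx)) hkx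
    simp only [sub_self] at hx
    linarith

theorem pow_three_dvd_of_derivative_derivative_eq_zero {f : ℝ[X]} (h0 : f.eval c = 0)
    (h1 : f.derivative.eval c = 0) (h2 : f.derivative.derivative.eval c = 0) :
    (X - C c) ^ 3 ∣ f := by
  rcases eq_or_ne f 0 with rfl | hf
  · exact dvd_zero _
  refine (le_rootMultiplicity_iff hf).1
    ((lt_rootMultiplicity_iff_isRoot_iterate_derivative (n := 2) hf).2 fun m hm => ?_)
  interval_cases m
  · exact h0
  · exact h1
  · exact h2

-- A zero of `f'` of order exactly two would be an inflection point of `f`.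
theorem sq_dvd_derivative_derivative_of_isLocalExtr {f : ℝ[X]}
    (hext : IsLocalExtr (fun x => f.eval x) c) (h2 : f.derivative.derivative.eval c = 0) :
    (X - C c) ^ 2 ∣ f.derivative.derivative := by
  obtain ⟨k, hk⟩ := pow_three_dvd_of_derivative_derivative_eq_zero (f := f - C (f.eval c)) (c := c)
    (by simp) (by simpa using hext.hasDerivAt_eq_zero (f.hasDerivAt c)) (by simpa using h2)
  have hval : ∀ x, (x - c) ^ 3 * k.eval x = f.eval x - f.eval c := fun x => by
    simpa using (congrArg (eval x) hk).symm
  have hk0 : k.eval c = 0 := eq_zero_of_isLocalExtr_cube_mul k.continuous.continuousAt <| by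
    simpa [IsLocalExtr, IsExtrFilter, IsMinFilter, IsMaxFilter, hval] using hext
  obtain ⟨r, rfl⟩ := dvd_iff_isRoot.2 hk0
  have hd : (X - C c) ^ 4 ∣ f - C (f.eval c) := ⟨r, by rw [hk]; ring⟩
  simpa using pow_sub_one_dvd_derivative_of_pow_dvd (pow_sub_one_dvd_derivative_of_pow_dvd hd)

theorem Equioscillates.derivative_derivative_ne_zero_of_card_eq (h : Equioscillates n α p E)
    (hc : c ∈ crit α p) (hcard : n ≤ (crit α p).card) : p.derivative.derivative.eval c ≠ 0 := by
  intro h0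
  have := h.card_crit_add_natDegree_le hc (dvd_iff_isRoot.2 h0) fun w hw => by
    rwa [show w = c by simpa [sub_eq_zero] using hw]
  rw [natDegree_X_sub_C] at this
  omega

theorem Equioscillates.sq_dvd_derivative_derivative (h : Equioscillates n α p E)
    (hc : c ∈ Ioo (-1 : ℝ) 1) (hcα : c ≠ α) (hcE : |err α p c| = E)
    (h0 : p.derivative.derivative.eval c = 0) : (X - C c) ^ 2 ∣ p.derivative.derivative := by
  have hext := h.isLocalExtr hc hcE
  rcases hcα.lt_or_gt with hlt | hlt
  · have heq : err α p =ᶠ[𝓝 c] fun x => (C α - X - p).eval x := by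
      filter_upwards [Iio_mem_nhds hlt] with y hy using err_of_le p (le_of_lt hy)
    simpa using sq_dvd_derivative_derivative_of_isLocalExtr (hext.congr heq) (by simpa using h0)
  · have heq : err α p =ᶠ[𝓝 c] fun x => (X - C α - p).eval x := by
      filter_upwards [Ioi_mem_nhds hlt] with y hy using err_of_ge p (le_of_lt hy)
    simpa using sq_dvd_derivative_derivative_of_isLocalExtr (hext.congr heq) (by simpa using h0)

theorem Equioscillates.derivative_derivative_ne_zero_of_abs_eq (h : Equioscillates n α p E)
    (hc : c ∈ Ioo (-1 : ℝ) 1) (hcα : c ≠ α) (hcE : |err α p c| = E)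
    (hcard : n ≤ (crit α p).card + 1) : p.derivative.derivative.eval c ≠ 0 := by
  intro h0
  have hcrit := h.mem_crit.2 (h.isCrit hc hcα hcE)
  have := h.card_crit_add_natDegree_le hcrit (h.sq_dvd_derivative_derivative hc hcα hcE h0)
    fun w hw => by rwa [show w = c by simpa [sub_eq_zero] using hw]
  rw [natDegree_pow, natDegree_X_sub_C] at this
  omega

theorem not_isLocalExtr_of_strictAntiOn {e : ℝ → ℝ} {a b : ℝ} (hac : a < c) (hcb : c < b)
    (he : StrictAntiOn e (Icc a b)) : ¬ IsLocalExtr e c := by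
  have hI : Icc a b ∈ 𝓝 c := Icc_mem_nhds hac hcb
  have hc : c ∈ Icc a b := ⟨hac.le, hcb.le⟩
  rintro (hmin | hmax)
  · obtain ⟨x, ⟨hx, hxI⟩, hcx⟩ := (((hmin.and hI).filter_mono nhdsWithin_le_nhds).and
      (self_mem_nhdsWithin (s := Ioi c))).exists
    exact (he hc hxI hcx).not_ge hx
  · obtain ⟨x, ⟨hx, hxI⟩, hxc⟩ := (((hmax.and hI).filter_mono nhdsWithin_le_nhds).and
      (self_mem_nhdsWithin (s := Iio c))).exists
    exact (he hxI hc hxc).not_ge hx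

theorem exists_strictAntiOn_err (h1 : p.derivative.eval α = 1)
    (h2 : 0 < p.derivative.derivative.eval α) :
    ∃ a < α, ∃ b > α, StrictAntiOn (err α p) (Icc a b) := by
  have hev : ∀ᶠ x in 𝓝 α, 0 < p.derivative.derivative.eval x ∧ -1 < p.derivative.eval x :=
    (p.derivative.derivative.continuous.continuousAt.eventually_const_lt h2).and
      (p.derivative.continuous.continuousAt.eventually_const_lt (by norm_num [h1]))
  obtain ⟨ε, hε, hball⟩ := Metric.nhds_basis_closedBall.eventually_iff.1 hev
  rw [Real.closedBall_eq_Icc] at hball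
  refine ⟨α - ε, by linarith, α + ε, by linarith, ?_⟩
  have hleft : StrictAntiOn (err α p) (Icc (α - ε) α) := strictAntiOn_err_left le_rfl fun x hx =>
    (hball ⟨hx.1.le, by linarith [hx.2]⟩).2
  have hmono : StrictMonoOn (fun x => p.derivative.eval x) (Icc α (α + ε)) :=
    strictMonoOn_eval_of_derivative_pos (convex_Icc _ _) fun x hx =>
      (hball ⟨by linarith [(interior_subset hx).1], (interior_subset hx).2⟩).1
  have hright : StrictAntiOn (err α p) (Icc α (α + ε)) := strictAntiOn_err_right le_rfl fun x hx =>
    h1.symm.trans_lt (hmono ⟨le_rfl, by linarith⟩ ⟨hx.1.le, hx.2.le⟩ hx.1)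
  have := hleft.union hright (isGreatest_Icc (by linarith)) (isLeast_Icc (by linarith))
  rwa [Icc_union_Icc_eq_Icc (by linarith) (by linarith)] at this

theorem Equioscillates.derivative_derivative_corner_pos (h : Equioscillates n α p E)
    (h1 : p.derivative.eval α = 1) (hcard : n ≤ (crit α p).card + 1) :
    0 < p.derivative.derivative.eval α := by
  have hαR : α ∉ critRight α p := fun hα => lt_irrefl _ (h.mem_critRight.1 hα).1
  have hg := h.derivative_derivative_ne_zero (Or.inl h1)
  refine derivative_pos_of_le_card (S := critLeft α p) (T := insert α (critRight α p)) hg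
    (Checkmark.natDegree_derivative_derivative_add_two_le h.natDegree_le hg)
    (by norm_num : (-1 : ℝ) < 1) (fun x hx y hy => ?_) (fun x hx => (h.mem_critLeft.1 hx).2)
    (fun y hy => ?_) ?_
    (fun x hx => (h.mem_critLeft.1 hx).1.le) fun y hy => ?_
  · rcases Finset.mem_insert.1 hy with rfl | hy
    · exact (h.mem_critLeft.1 hx).1
    · exact h.lt_of_mem_crit hx hy
  · rcases Finset.mem_insert.1 hy with rfl | hy
    · exact h1
    · exact (h.mem_critRight.1 hy).2
  · rw [Finset.card_insert_of_notMem hαR, ← add_assoc, ← h.card_crit]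
    exact hcard
  · rcases Finset.mem_insert.1 hy with rfl | hy
    · exact le_rfl
    · exact (h.mem_critRight.1 hy).1.le

theorem Equioscillates.derivative_corner_ne_one (h : Equioscillates n α p E)
    (hα : α ∈ Ioo (-1 : ℝ) 1) (hcard : n ≤ (crit α p).card + 1) : p.derivative.eval α ≠ 1 := by
  intro h1
  obtain ⟨a, ha, b, hb, hanti⟩ :=
    exists_strictAntiOn_err h1 (h.derivative_derivative_corner_pos h1 hcard)
  exact not_isLocalExtr_of_strictAntiOn ha hb hanti
    (h.isLocalExtr hα (h.mem_extr.1 (h.corner_mem_extr (Ioo_subset_Icc_self hα))).2)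

theorem Equioscillates.derivative_corner_ne_neg_one (h : Equioscillates n α p E)
    (hα : α ∈ Ioo (-1 : ℝ) 1) (hcard : n ≤ (crit α p).card + 1) :
    p.derivative.eval α ≠ -1 := by
  intro h1
  refine h.reflect.derivative_corner_ne_one (by simpa [neg_lt, and_comm] using hα) ?_ ?_
  · rwa [h.crit_comp_neg, Finset.card_map]
  · simp [derivative_comp_neg, h1]

end Nondegeneracy

section VShapes

variable {g : ℝ → ℝ} {F : Set ℝ} {a b c a' b' c' lo hi m k m' k' : ℝ}

theorem eq_and_eq_of_forall_affine_eq (hab : a < b)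
    (h : ∀ x ∈ Icc a b, m * x + k = m' * x + k') : m = m' ∧ k = k' := by
  have ha := h a (left_mem_Icc.2 hab.le)
  have hb := h b (right_mem_Icc.2 hab.le)
  have hm : m = m' :=
    sub_eq_zero.1 ((mul_eq_zero.1 (show (m - m') * (b - a) = 0 by linarith)).resolve_right
      (sub_pos.2 hab).ne')
  exact ⟨hm, by subst hm; linarith⟩

theorem exists_isLeast_Icc_subset (hF : IsClosed F) (hlo : lo ≤ a) (hab : a < b)
    (h : Icc a b ⊆ F) : ∃ x, IsLeast {x ∈ Icc lo a | Icc x b ⊆ F} x := by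
  have ha : a ∈ {x ∈ Icc lo a | Icc x b ⊆ F} := ⟨⟨hlo, le_rfl⟩, h⟩
  have hbdd : BddBelow {x ∈ Icc lo a | Icc x b ⊆ F} := ⟨lo, fun x hx => hx.1.1⟩
  refine ⟨_, ⟨⟨le_csInf ⟨a, ha⟩ fun x hx => hx.1.1, csInf_le hbdd ha⟩, ?_⟩,
    fun x hx => csInf_le hbdd hx⟩
  rw [← closure_Ioc ((csInf_le hbdd ha).trans_lt hab).ne]
  refine closure_minimal (fun y hy => ?_) hF
  obtain ⟨x, hx, hxy⟩ := exists_lt_of_csInf_lt ⟨a, ha⟩ hy.1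
  exact hx.2 ⟨hxy.le, hy.2⟩

theorem exists_isGreatest_Icc_subset (hF : IsClosed F) (hab : a < b) (hhi : b ≤ hi)
    (h : Icc a b ⊆ F) : ∃ x, IsGreatest {x ∈ Icc b hi | Icc a x ⊆ F} x := by
  have hb : b ∈ {x ∈ Icc b hi | Icc a x ⊆ F} := ⟨⟨le_rfl, hhi⟩, h⟩
  have hbdd : BddAbove {x ∈ Icc b hi | Icc a x ⊆ F} := ⟨hi, fun x hx => hx.1.2⟩
  refine ⟨_, ⟨⟨le_csSup hbdd hb, csSup_le ⟨b, hb⟩ fun x hx => hx.1.2⟩, ?_⟩,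
    fun x hx => le_csSup hbdd hx⟩
  rw [← closure_Ico (hab.trans_le (le_csSup hbdd hb)).ne]
  refine closure_minimal (fun y hy => ?_) hF
  obtain ⟨x, hx, hxy⟩ := exists_lt_of_lt_csSup ⟨b, hb⟩ hy.2
  exact hx.2 ⟨hy.1, hxy.le⟩

theorem IsVOn.reflect (hg : ∀ x, g (-x) = g x) (h : IsVOn g a b c) :
    IsVOn g (-c) (-b) (-a) where
  left_mem := neg_le_neg h.right_mem
  left_lt := neg_lt_neg h.lt_right
  lt_right := neg_lt_neg h.left_lt
  right_mem := neg_le.1 h.left_mem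
  decreasing := by
    obtain ⟨m, k, hm, hinc⟩ := h.increasing
    refine ⟨-m, k, neg_lt_zero.2 hm, fun x hx => ?_⟩
    rw [← hg, hinc (-x) ⟨le_neg.1 hx.2, neg_le.1 hx.1⟩, neg_mul_comm]
  increasing := by
    obtain ⟨m, k, hm, hdec⟩ := h.decreasing
    refine ⟨-m, k, neg_pos.2 hm, fun x hx => ?_⟩
    rw [← hg, hdec (-x) ⟨le_neg.1 hx.2, neg_le.1 hx.1⟩, neg_mul_comm]

theorem IsVShape.reflect (hg : ∀ x, g (-x) = g x) (h : IsVShape g a b c) :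
    IsVShape g (-c) (-b) (-a) := by
  refine ⟨h.1.reflect hg, fun a' b' c' h' ha hc => ?_⟩
  have := h.2 (-c') (-b') (-a') (h'.reflect hg) (neg_le.1 hc) (le_neg.1 ha)
  exact ⟨neg_eq_iff_eq_neg.1 this.2, neg_eq_iff_eq_neg.1 this.1⟩

theorem IsVOn.tip_le (h : IsVOn g a b c) (h' : IsVOn g a' b' c') (hc : b ≤ c') : b ≤ b' := by
  by_contra! hlt
  obtain ⟨m, k, hm, hdec⟩ := h.decreasing
  obtain ⟨m', k', hm', hinc⟩ := h'.increasing
  have := eq_and_eq_of_forall_affine_eq (max_lt h.left_lt hlt) fun x hx =>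
    (hdec x ⟨(le_max_left _ _).trans hx.1, hx.2⟩).symm.trans
      (hinc x ⟨(le_max_right _ _).trans hx.1, hx.2.trans hc⟩)
  linarith [this.1]

theorem IsVOn.le_tip (h : IsVOn g a b c) (h' : IsVOn g a' b' c') (ha : a' ≤ b) : b' ≤ b := by
  by_contra! hlt
  obtain ⟨m, k, hm, hinc⟩ := h.increasing
  obtain ⟨m', k', hm', hdec⟩ := h'.decreasing
  have := eq_and_eq_of_forall_affine_eq (lt_min h.lt_right hlt) fun x hx =>
    (hinc x ⟨hx.1, hx.2.trans (min_le_left _ _)⟩).symm.trans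
      (hdec x ⟨ha.trans hx.1, hx.2.trans (min_le_right _ _)⟩)
  linarith [this.1]

theorem IsVOn.exists_isVShape (hg : Continuous g) (h : IsVOn g a b c) :
    ∃ a' c', a' ≤ a ∧ c ≤ c' ∧ IsVShape g a' b c' := by
  obtain ⟨m, k, hm, hdec⟩ := h.decreasing
  obtain ⟨m', k', hm', hinc⟩ := h.increasing
  have hclosed (m k : ℝ) : IsClosed {x | g x = m * x + k} := isClosed_eq hg (by fun_prop)
  obtain ⟨a', ⟨⟨ha1, ha⟩, hdec'⟩, hleast⟩ :=
    exists_isLeast_Icc_subset (hclosed m k) h.left_mem h.left_lt hdec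
  obtain ⟨c', ⟨⟨hc, hc1⟩, hinc'⟩, hgreatest⟩ :=
    exists_isGreatest_Icc_subset (hclosed m' k') h.lt_right h.right_mem hinc
  have hab : a' < b := ha.trans_lt h.left_lt
  have hbc : b < c' := h.lt_right.trans_le hc
  have hV : IsVOn g a' b c' := ⟨ha1, hab, hbc, hc1, ⟨m, k, hm, hdec'⟩, ⟨m', k', hm', hinc'⟩⟩
  refine ⟨a', c', ha, hc, hV, fun a'' b'' c'' hW ha' hc' => ?_⟩
  obtain rfl : b'' = b :=
    (hV.le_tip hW (ha'.trans hab.le)).antisymm (hV.tip_le hW (hbc.le.trans hc'))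
  obtain ⟨μ, κ, -, hdec''⟩ := hW.decreasing
  obtain ⟨μ', κ', -, hinc''⟩ := hW.increasing
  obtain ⟨rfl, rfl⟩ := eq_and_eq_of_forall_affine_eq hab fun x hx =>
    (hdec' hx).symm.trans (hdec'' x ⟨ha'.trans hx.1, hx.2⟩)
  obtain ⟨rfl, rfl⟩ := eq_and_eq_of_forall_affine_eq hbc fun x hx =>
    (hinc' hx).symm.trans (hinc'' x ⟨hx.1, hx.2.trans hc'⟩)
  exact ⟨ha'.antisymm (hleast ⟨⟨hW.left_mem, ha'.trans ha⟩, hdec''⟩),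
    (hgreatest ⟨⟨hc.trans hc', hW.right_mem⟩, hinc''⟩).antisymm hc'⟩

end VShapes

section Tips

variable {n : ℕ} {α E s : ℝ} {p : ℝ[X]}

theorem Equioscillates.minimaxError_scale (h : Equioscillates n α p E) {z : Fin (n + 2) → ℝ}
    (hz : Alternates (err α p) (Icc (-1) 1) E z) (hs : 1 ≤ s) (hzs : ∀ i, s * (z i + 1) ≤ 2) :
    minimaxError n (s * (α + 1) - 1) = s * E := by
  have hs0 : 0 < s := by linarith
  have hz' : Alternates (err α p) (Icc (-1) (2 / s - 1)) E z :=
    ⟨hz.strictMono, fun i => ⟨(hz.mem i).1, le_sub_iff_add_le.2 ((le_div_iff₀' hs0).2 (hzs i))⟩,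
      hz.sign⟩
  refine (hz'.equioscillates_scalePoly hs0 h.pos h.natDegree_le fun x hx =>
    h.abs_err_le x ⟨hx.1, hx.2.trans ?_⟩).minimaxError_eq
  rw [sub_le_iff_le_add, div_le_iff₀ hs0]
  linarith

theorem Equioscillates.exists_affine_right (h : Equioscillates n α p E) (hα : α ∈ Ioo (-1 : ℝ) 1)
    {z : Fin (n + 2) → ℝ} (hz : Alternates (err α p) (Icc (-1) 1) E z)
    (hlt : z (Fin.last _) < 1) :
    ∃ c, α < c ∧ c ≤ 1 ∧ ∀ x ∈ Icc α c, minimaxError n x = E / (α + 1) * (x + 1) := by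
  have hα1 : 0 < α + 1 := by linarith [hα.1]
  have hle : ∀ i, z i ≤ z (Fin.last _) := fun i => hz.strictMono.monotone (Fin.le_last i)
  obtain ⟨j, hj⟩ := h.exists_eq_corner (Ioo_subset_Icc_self hα) hz
  have hαt : α ≤ z (Fin.last _) := hj ▸ hle j
  have ht : 0 < z (Fin.last _) + 1 := by linarith
  refine ⟨2 / (z (Fin.last _) + 1) * (α + 1) - 1, ?_, ?_, fun x hx => ?_⟩
  · have := mul_lt_mul_of_pos_right ((one_lt_div ht).2 (by linarith : _ < (2 : ℝ))) hα1
    linarith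
  · rw [sub_le_iff_le_add, div_mul_eq_mul_div, div_le_iff₀ ht]
    linarith
  · have hx' : (x + 1) / (α + 1) * (α + 1) - 1 = x := by rw [div_mul_cancel₀ _ hα1.ne']; ring
    have hs : 1 ≤ (x + 1) / (α + 1) := (one_le_div hα1).2 (by linarith [hx.1])
    have hst : (x + 1) / (α + 1) * (z (Fin.last _) + 1) ≤ 2 :=
      (le_div_iff₀ ht).1 ((div_le_iff₀ hα1).2 (by linarith [hx.2]))
    have := h.minimaxError_scale hz hs fun i => le_trans (by gcongr; exact hle i) hst
    rw [hx'] at this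
    rw [this]
    ring

theorem Equioscillates.extr_eq_of_card (h : Equioscillates n α p E)
    (hcard : n + 3 ≤ (extr α p E).card) :
    extr α p E = insert α (insert (-1) (insert 1 (crit α p))) :=
  Finset.eq_of_subset_of_card_le (extr_subset α E p) <|
    (card_insert_insert_insert_le _ _ _ _).trans <|
      (Nat.add_le_add_right h.card_crit_le 3).trans hcard

theorem Equioscillates.exists_affine_right_of_card (h : Equioscillates n α p E)
    (hα : α ∈ Ioo (-1 : ℝ) 1) (hcard : n + 3 ≤ (extr α p E).card) :
    ∃ c, α < c ∧ c ≤ 1 ∧ ∀ x ∈ Icc α c, minimaxError n x = E / (α + 1) * (x + 1) := by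
  have hcrit : crit α p ⊆ extr α p E := by
    rw [h.extr_eq_of_card hcard]
    exact fun x hx => by simp [hx]
  have hZ := h.alternates_orderEmb (Ioo_subset_Icc_self hα) hcrit (h.card_extr_le.antisymm hcard)
  obtain ⟨ε, hε, hsign⟩ := hZ.sign
  exact h.exists_affine_right hα
    ⟨hZ.strictMono.comp Fin.strictMono_castSucc, fun i => hZ.mem _, ε, hε, fun i => hsign _⟩
    ((hZ.strictMono (Fin.castSucc_lt_last _)).trans_le (hZ.mem _).2)

theorem Equioscillates.exists_isVOn_of_card (h : Equioscillates n α p E) (hα : α ∈ Ioo (-1 : ℝ) 1)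
    (hcard : n + 3 ≤ (extr α p E).card) : ∃ a c, IsVOn (minimaxError n) a α c := by
  obtain ⟨c, hc, hc1, hright⟩ := h.exists_affine_right_of_card hα hcard
  obtain ⟨a, ha, ha1, hleft⟩ := h.reflect.exists_affine_right_of_card
    (by simpa [neg_lt, and_comm] using hα) (by rwa [h.extr_comp_neg, Finset.card_map])
  have hslope : 0 < E / (α + 1) := div_pos h.pos (by linarith [hα.1])
  have hslope' : 0 < E / (-α + 1) := div_pos h.pos (by linarith [hα.2])
  refine ⟨-a, c, neg_le_neg ha1, neg_lt.1 ha, hc, hc1,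
    ⟨-(E / (-α + 1)), E / (-α + 1), neg_lt_zero.2 hslope', fun x hx => ?_⟩,
    ⟨E / (α + 1), E / (α + 1), hslope, fun x hx => ?_⟩⟩
  · rw [← minimaxError_neg, hleft (-x) ⟨neg_le_neg hx.2, neg_le.1 hx.1⟩]
    ring
  · rw [hright x hx]
    ring

end Tips

section Turning

variable {Q : ℝ[X]} {a u E : ℝ}

theorem derivative_derivative_neg_of_le (hu : u < a) (hle : ∀ x ∈ Icc u a, Q.eval x ≤ Q.eval a)
    (hd : Q.derivative.eval a = 0) (hdd : Q.derivative.derivative.eval a ≠ 0) :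
    Q.derivative.derivative.eval a < 0 := by
  have hderiv : deriv (fun x => Q.eval x) = fun x => Q.derivative.eval x := funext fun _ => Q.deriv
  refine hdd.lt_of_le (not_lt.1 fun hpos => hdd ?_)
  have hmin : IsLocalMin (fun x => Q.eval x) a :=
    isLocalMin_of_deriv_deriv_pos (by rwa [hderiv, Polynomial.deriv]) (by rwa [hderiv])
      Q.continuous.continuousAt
  obtain ⟨v, hv, hva⟩ :=
    (mem_nhdsLT_iff_exists_Ioo_subset' hu).1 (hmin.filter_mono nhdsWithin_le_nhds)
  have hconst : Q = C (Q.eval a) := by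
    refine eq_of_infinite_eval_eq _ _ ((Ioo_infinite (max_lt hu hv)).mono fun x hx => ?_)
    rw [mem_ofPred_eq, eval_C]
    exact (hle x ⟨(le_max_left _ _).trans hx.1.le, hx.2.le⟩).antisymm
      (hva ⟨(le_max_right _ _).trans_lt hx.1, hx.2⟩)
  rw [hconst]
  simp

theorem strictAntiOn_eval_Ici (hd : Q.derivative.eval a = 0)
    (hdd : Q.derivative.derivative.eval a < 0) (hne : ∀ x, a < x → Q.derivative.eval x ≠ 0) :
    StrictAntiOn (fun x => Q.eval x) (Ici a) := by
  have hsign := eventually_nhdsWithin_sign_eq_of_deriv_neg (f := fun x => Q.derivative.eval x)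
    (by rwa [Polynomial.deriv]) hd
  obtain ⟨y, hy, hay⟩ := ((hsign.filter_mono nhdsWithin_le_nhds).and
    (self_mem_nhdsWithin : Ioi a ∈ 𝓝[>] a)).exists
  have hyneg : Q.derivative.eval y < 0 := by
    rwa [sign_neg (sub_neg.2 hay), sign_eq_neg_one_iff] at hy
  refine strictAntiOn_of_deriv_neg (convex_Ici a) Q.continuous.continuousOn fun x hx => ?_
  rw [interior_Ici] at hx
  rw [Polynomial.deriv]
  by_contra! hcon
  obtain ⟨w, hw, hw0⟩ := isPreconnected_Ioi.intermediate_value hay hx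
    Q.derivative.continuous.continuousOn ⟨hyneg.le, hcon⟩
  exact hne w hw hw0

theorem exists_eval_eq_neg (ha : 0 < Q.eval a) (hanti : StrictAntiOn (fun x => Q.eval x) (Ici a)) :
    ∃ t, a < t ∧ Q.eval t = -Q.eval a := by
  have hdeg : 0 < Q.degree := by
    rw [← natDegree_pos_iff_degree_pos, Nat.pos_iff_ne_zero]
    intro h0
    have hlt := hanti self_mem_Ici (mem_Ici.2 (lt_add_one a).le) (lt_add_one a)
    rw [eq_C_of_natDegree_eq_zero h0] at hlt
    simp at hlt
  obtain ⟨y, hyE, hay⟩ := ((Q.abs_tendsto_atTop hdeg).eventually_gt_atTop (Q.eval a) |>.and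
    (eventually_gt_atTop a)).exists
  have hya : Q.eval y < Q.eval a := hanti self_mem_Ici (mem_Ici.2 hay.le) hay
  have hyneg : Q.eval y < -Q.eval a := by
    rcases lt_abs.1 hyE with hlt | hlt <;> linarith
  obtain ⟨t, ht, hta⟩ := intermediate_value_Icc' hay.le Q.continuous.continuousOn
    ⟨hyneg.le, by linarith⟩
  refine ⟨t, ht.1.lt_of_ne ?_, hta⟩
  rintro rfl
  linarith [show Q.eval a = -Q.eval a from hta]

theorem exists_eval_eq_neg_and_abs_le (hE : 0 < E) (hu : u < a)
    (hle : ∀ x ∈ Icc u a, |Q.eval x| ≤ E) (ha : |Q.eval a| = E) (hd : Q.derivative.eval a = 0)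
    (hdd : Q.derivative.derivative.eval a ≠ 0) (hne : ∀ x, a < x → Q.derivative.eval x ≠ 0) :
    ∃ t, a < t ∧ Q.eval t = -Q.eval a ∧ ∀ x ∈ Icc a t, |Q.eval x| ≤ E := by
  wlog hpos : Q.eval a = E generalizing Q with H
  · have hneg : Q.eval a = -E := (eq_or_eq_neg_of_abs_eq ha).resolve_left hpos
    simpa [neg_eq_iff_eq_neg] using H (Q := -Q) (by simpa using hle) (by simpa using ha)
      (by simpa using hd) (by simpa using hdd) (by simpa using hne) (by simp [hneg])
  have hanti := strictAntiOn_eval_Ici hd (derivative_derivative_neg_of_le hu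
    (fun x hx => (le_abs_self _).trans ((hle x hx).trans hpos.ge)) hd hdd) hne
  obtain ⟨t, hat, ht⟩ := exists_eval_eq_neg (hpos ▸ hE) hanti
  refine ⟨t, hat, ht, fun x hx => abs_le.2 ⟨?_, ?_⟩⟩
  · rw [← hpos, ← ht]
    exact hanti.antitoneOn (mem_Ici.2 hx.1) (mem_Ici.2 hat.le) hx.2
  · rw [← hpos]
    exact hanti.antitoneOn self_mem_Ici (mem_Ici.2 hx.1) hx.1

end Turning

section EndpointCrit

variable {n : ℕ} {α E s t : ℝ} {p : ℝ[X]}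

theorem Equioscillates.extr_eq_of_one_mem_crit (h : Equioscillates n α p E) (h1 : 1 ∈ crit α p) :
    extr α p E = insert α (insert (-1) (crit α p)) ∧ n ≤ (crit α p).card ∧
      (extr α p E).card = n + 2 := by
  have hsub := extr_subset α E p
  rw [Finset.insert_eq_of_mem h1] at hsub
  have hα := Finset.card_insert_le α (insert (-1) (crit α p))
  have hneg := Finset.card_insert_le (-1) (crit α p)
  have hcrit := h.card_crit_le
  have hextr := h.le_card_extr
  have hle := Finset.card_le_card hsub
  exact ⟨Finset.eq_of_subset_of_card_le hsub (by omega), by omega, by omega⟩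

theorem Equioscillates.exists_err_eq_neg_of_one_mem_crit (h : Equioscillates n α p E)
    (hα : α ∈ Ioo (-1 : ℝ) 1) (h1 : 1 ∈ crit α p) :
    ∃ t, 1 < t ∧ err α p t = -err α p 1 ∧ ∀ x ∈ Icc (-1) t, |err α p x| ≤ E := by
  obtain ⟨hextr, hcard, -⟩ := h.extr_eq_of_one_mem_crit h1
  have hcrit : ∀ x ∈ crit α p, x ∈ Icc (-1 : ℝ) 1 ∧ |err α p x| = E := fun x hx =>
    h.mem_extr.1 (by simp [hextr, hx])
  obtain ⟨t, ht, hneg, hle⟩ := exists_eval_eq_neg_and_abs_le (Q := X - C α - p) h.pos hα.2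
    (fun x hx => err_of_ge p hx.1 ▸ h.abs_err_le x ⟨hα.1.le.trans hx.1, hx.2⟩)
    (err_of_ge p hα.2.le ▸ (hcrit 1 h1).2)
    (by simpa [sub_eq_zero] using
      (((h.mem_crit.1 h1).resolve_left fun hleft => hα.2.not_gt hleft.1).2).symm)
    (by simpa using h.derivative_derivative_ne_zero_of_card_eq h1 hcard)
    (fun x hx h0 => (hcrit x (h.mem_crit.2 (Or.inr ⟨hα.2.trans hx, by
      exact (sub_eq_zero.1 (by simpa using h0)).symm⟩))).1.2.not_gt hx)
  refine ⟨t, ht, by rw [err_of_ge p (hα.2.trans ht).le, err_of_ge p hα.2.le, hneg], fun x hx => ?_⟩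
  rcases le_total x 1 with hx1 | hx1
  · exact h.abs_err_le x ⟨hx.1, hx1⟩
  · rw [err_of_ge p (hα.2.le.trans hx1)]
    exact hle x ⟨hx1, hx.2⟩

theorem Equioscillates.equioscillates_scalePoly (h : Equioscillates n α p E)
    (hle : ∀ x ∈ Icc (-1) t, |err α p x| ≤ E) (hs : 0 < s) (hs1 : s ≤ 1)
    (hst : 2 ≤ s * (t + 1)) : Equioscillates n (s * (α + 1) - 1) (scalePoly s p) (s * E) := by
  obtain ⟨z, hz⟩ := h.alternates
  have h1s : 1 ≤ 2 / s - 1 := by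
    rw [le_sub_iff_add_le, le_div_iff₀ hs]
    linarith
  refine Alternates.equioscillates_scalePoly hs
    ⟨hz.strictMono, fun i => ⟨(hz.mem i).1, (hz.mem i).2.trans h1s⟩, hz.sign⟩ h.pos h.natDegree_le
    fun x hx => hle x ⟨hx.1, hx.2.trans ?_⟩
  rwa [sub_le_iff_le_add, div_le_iff₀' hs]

theorem Equioscillates.minimaxError_eq_of_le (h : Equioscillates n α p E) (hα : -1 < α)
    (ht : 1 ≤ t) (hle : ∀ x ∈ Icc (-1) t, |err α p x| ≤ E) {x : ℝ}
    (hx : x ∈ Icc (2 / (t + 1) * (α + 1) - 1) α) : minimaxError n x = E / (α + 1) * (x + 1) := by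
  have hα1 : 0 < α + 1 := by linarith
  have ht1 : 0 < t + 1 := by linarith
  have hσ : 2 / (t + 1) ≤ (x + 1) / (α + 1) := (le_div_iff₀ hα1).2 (by linarith [hx.1])
  have hx' : (x + 1) / (α + 1) * (α + 1) - 1 = x := by rw [div_mul_cancel₀ _ hα1.ne']; ring
  have := h.equioscillates_scalePoly hle ((div_pos two_pos ht1).trans_le hσ)
    ((div_le_one hα1).2 (by linarith [hx.2])) ((div_le_iff₀ ht1).1 hσ)
  rw [hx'] at this
  rw [this.minimaxError_eq]
  ring

theorem Equioscillates.le_card_extr_scalePoly (h : Equioscillates n α p E) (ht : 1 < t)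
    (htE : |err α p t| = E) (hle : ∀ x ∈ Icc (-1) t, |err α p x| ≤ E) :
    n + 3 ≤ (extr (2 / (t + 1) * (α + 1) - 1) (scalePoly (2 / (t + 1)) p)
      (2 / (t + 1) * E)).card := by
  have ht1 : 0 < t + 1 := by linarith
  have hσ : 0 < 2 / (t + 1) := div_pos two_pos ht1
  have hσt : 2 / (t + 1) * (t + 1) = 2 := div_mul_cancel₀ _ ht1.ne'
  have hopt := h.equioscillates_scalePoly hle hσ ((div_le_one ht1).2 (by linarith)) hσt.ge
  have htextr : t ∉ extr α p E := fun hmem => (h.mem_extr.1 hmem).1.2.not_gt ht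
  have hcard : n + 3 ≤ (insert t (extr α p E)).card := by
    rw [Finset.card_insert_of_notMem htextr]
    exact Nat.succ_le_succ h.le_card_extr
  refine hcard.trans (Finset.card_le_card_of_injOn (fun x => 2 / (t + 1) * (x + 1) - 1)
    (fun x hx => hopt.mem_extr.2 ?_) fun x _ y _ hxy => by simpa [hσ.ne'] using hxy)
  obtain ⟨hx, hxE⟩ : x ∈ Icc (-1) t ∧ |err α p x| = E := by
    rcases Finset.mem_insert.1 hx with rfl | hx
    · exact ⟨⟨by linarith, le_rfl⟩, htE⟩
    · have := h.mem_extr.1 hx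
      exact ⟨⟨this.1.1, this.1.2.trans ht.le⟩, this.2⟩
  have hx0 := mul_nonneg hσ.le (neg_le_iff_add_nonneg.1 hx.1)
  have hxt := mul_le_mul_of_nonneg_left (add_le_add_left hx.2 1) hσ.le
  exact ⟨⟨by linarith, by linarith⟩, by rw [err_scalePoly hσ, abs_mul, abs_of_pos hσ, hxE]⟩

theorem Equioscillates.exists_isVOn_of_one_mem_crit (h : Equioscillates n α p E)
    (hα : α ∈ Ioo (-1 : ℝ) 1) (h1 : 1 ∈ crit α p) :
    ∃ a b, IsVOn (minimaxError n) a b α ∧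
      ∀ x ∈ Icc b α, minimaxError n x = E / (α + 1) * (x + 1) := by
  obtain ⟨t, ht, hneg, hle⟩ := h.exists_err_eq_neg_of_one_mem_crit hα h1
  have h1E : |err α p 1| = E :=
    (h.mem_extr.1 (by simp [(h.extr_eq_of_one_mem_crit h1).1, h1])).2
  have hα1 : 0 < α + 1 := by linarith [hα.1]
  have ht1 : 0 < t + 1 := by linarith
  have hσ : 0 < 2 / (t + 1) := div_pos two_pos ht1
  have hσ1 : 2 / (t + 1) < 1 := (div_lt_one ht1).2 (by linarith)
  have hopt := h.equioscillates_scalePoly hle hσ hσ1.le (div_mul_cancel₀ _ ht1.ne').ge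
  have hβα : 2 / (t + 1) * (α + 1) - 1 < α := by
    linarith [mul_lt_of_lt_one_left hα1 hσ1]
  obtain ⟨a, c, hV⟩ := hopt.exists_isVOn_of_card
    ⟨by linarith [mul_pos hσ hα1], hβα.trans hα.2⟩
    (h.le_card_extr_scalePoly ht (by rw [hneg, abs_neg, h1E]) hle)
  have haff := fun x hx => h.minimaxError_eq_of_le (x := x) hα.1 ht.le hle hx
  refine ⟨a, _, ⟨hV.left_mem, hV.left_lt, hβα, hα.2.le, hV.decreasing,
    E / (α + 1), E / (α + 1), div_pos h.pos hα1, fun x hx => ?_⟩, haff⟩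
  rw [haff x hx]
  ring

theorem Equioscillates.equioscillates_scalePoly_of_minimaxError_eq (h : Equioscillates n α p E)
    (hs : 1 ≤ s) (he : minimaxError n (s * (α + 1) - 1) = s * E) :
    Equioscillates n (s * (α + 1) - 1) (scalePoly s p) (s * E) := by
  have hs0 : 0 < s := by linarith
  have hdeg := (natDegree_scalePoly_le s p).trans h.natDegree_le
  have hle : maxErr (s * (α + 1) - 1) (scalePoly s p) ≤ s * E := by
    refine maxErr_le_iff.2 fun y hy => ?_
    obtain ⟨x, rfl⟩ : ∃ x, s * (x + 1) - 1 = y := ⟨(y + 1) / s - 1, by field_simp; ring⟩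
    rw [err_scalePoly hs0, abs_mul, abs_of_pos hs0]
    refine mul_le_mul_of_nonneg_left (h.abs_err_le x ⟨?_, ?_⟩) hs0.le
    · linarith [(mul_nonneg_iff_of_pos_left hs0).1 (show 0 ≤ s * (x + 1) by linarith [hy.1])]
    · by_contra! hx
      nlinarith [hy.2]
  have heq : maxErr (s * (α + 1) - 1) (scalePoly s p) = s * E :=
    hle.antisymm (he ▸ (minimaxPoly_isMinimax n _).maxErr_le hdeg)
  rw [← heq]
  refine IsMinimax.equioscillates ⟨mem_degreeLE_iff.2 hdeg, fun q hq => ?_⟩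
    (heq ▸ mul_pos hs0 h.pos)
  exact (heq.trans he.symm).trans_le ((minimaxPoly_isMinimax n _).2 q hq)

theorem Equioscillates.minimaxError_scale_ne (h : Equioscillates n α p E) (h1 : 1 ∈ extr α p E)
    (hcard : (extr α p E).card ≤ n + 2) (hs : 1 < s) :
    minimaxError n (s * (α + 1) - 1) ≠ s * E := by
  intro he
  have hs0 : 0 < s := by linarith
  have hopt := h.equioscillates_scalePoly_of_minimaxError_eq hs.le he
  have hle : (extr (s * (α + 1) - 1) (scalePoly s p) (s * E)).card ≤
      ((extr α p E).erase 1).card := by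
    refine Finset.card_le_card_of_injOn (fun y => (y + 1) / s - 1) (fun y hy => ?_)
      fun x _ y _ hxy => by simpa [hs0.ne'] using hxy
    obtain ⟨x, rfl⟩ : ∃ x, s * (x + 1) - 1 = y := ⟨(y + 1) / s - 1, by field_simp; ring⟩
    obtain ⟨⟨hy0, hy1⟩, hyE⟩ := hopt.mem_extr.1 hy
    rw [err_scalePoly hs0, abs_mul, abs_of_pos hs0, mul_right_inj' hs0.ne'] at hyE
    have hx0 := (mul_nonneg_iff_of_pos_left hs0).1 (show 0 ≤ s * (x + 1) by linarith)
    have hx1 : x < 1 := by nlinarith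
    beta_reduce
    rw [sub_add_cancel, mul_div_cancel_left₀ _ hs0.ne', add_sub_cancel_right]
    exact Finset.mem_coe.2 (Finset.mem_erase.2
      ⟨hx1.ne, h.mem_extr.2 ⟨⟨neg_le_iff_add_nonneg.2 hx0, hx1.le⟩, hyE⟩⟩)
  rw [Finset.card_erase_of_mem h1] at hle
  have := hopt.le_card_extr
  omega

theorem Equioscillates.exists_isVShape_of_one_mem_crit (h : Equioscillates n α p E)
    (hα : α ∈ Ioo (-1 : ℝ) 1) (h1 : 1 ∈ crit α p) :
    ∃ a b, IsVShape (minimaxError n) a b α := by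
  obtain ⟨hextr, -, hcard⟩ := h.extr_eq_of_one_mem_crit h1
  obtain ⟨a, b, hV, haff⟩ := h.exists_isVOn_of_one_mem_crit hα h1
  obtain ⟨a', c, -, hc, hshape⟩ := hV.exists_isVShape (continuous_minimaxError n)
  obtain rfl | hlt := hc.eq_or_lt
  · exact ⟨a', b, hshape⟩
  have hα1 : 0 < α + 1 := by linarith [hα.1]
  obtain ⟨m, k, -, hinc⟩ := hshape.1.increasing
  obtain ⟨hm, hk⟩ := eq_and_eq_of_forall_affine_eq hV.lt_right (m' := E / (α + 1))
    (k' := E / (α + 1)) fun x hx => by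
      rw [← hinc x ⟨hx.1, hx.2.trans hc⟩, haff x hx]
      ring
  refine absurd ?_ (h.minimaxError_scale_ne (s := (c + 1) / (α + 1)) (by simp [hextr, h1])
    hcard.le ((one_lt_div hα1).2 (by linarith)))
  rw [div_mul_cancel₀ _ hα1.ne', add_sub_cancel_right, hinc c ⟨hV.lt_right.le.trans hc, le_rfl⟩,
    hm, hk]
  ring

theorem Equioscillates.exists_isVShape_of_neg_one_mem_crit (h : Equioscillates n α p E)
    (hα : α ∈ Ioo (-1 : ℝ) 1) (h1 : -1 ∈ crit α p) :
    ∃ b c, IsVShape (minimaxError n) α b c := by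
  obtain ⟨a, b, hV⟩ := h.reflect.exists_isVShape_of_one_mem_crit
    (by simpa [neg_lt, and_comm] using hα) (by
      rw [h.crit_comp_neg, Finset.mem_map_equiv]
      simpa using h1)
  have := hV.reflect (minimaxError_neg n)
  rw [neg_neg] at this
  exact ⟨_, _, this⟩

end EndpointCrit

section Coefficients

theorem continuousAt_of_forall_norm_sub_le {X V W : Type*} [TopologicalSpace X]
    [NormedAddCommGroup V] [NormedSpace ℝ V] [FiniteDimensional ℝ V] [NormedAddCommGroup W]
    [NormedSpace ℝ W] {T : V →ₗ[ℝ] W} (hT : Function.Injective T) {f : X → W} {c : X → V} {x₀ : X}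
    (hf : ContinuousAt f x₀) (hmin : ∀ x v, ‖f x - T (c x)‖ ≤ ‖f x - T v‖)
    (huniq : ∀ v, (∀ w, ‖f x₀ - T v‖ ≤ ‖f x₀ - T w‖) → v = c x₀) : ContinuousAt c x₀ := by
  have : ProperSpace V := FiniteDimensional.proper ℝ V
  have hTc : Continuous T := T.continuous_of_finiteDimensional
  obtain ⟨K, -, hanti⟩ := T.exists_antilipschitzWith (LinearMap.ker_eq_bot.2 hT)
  have hbound : ∀ᶠ x in 𝓝 x₀, c x ∈ Metric.closedBall 0 (K * (2 * (‖f x₀‖ + 1))) := by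
    filter_upwards [hf.norm.eventually (gt_mem_nhds (lt_add_one ‖f x₀‖))] with x hx
    have hle : ‖c x‖ ≤ K * ‖T (c x)‖ := by simpa using hanti.le_mul_dist (c x) 0
    have hzero : ‖f x - T (c x)‖ ≤ ‖f x‖ := by simpa using hmin x 0
    have htri : ‖T (c x)‖ ≤ ‖f x‖ + ‖f x - T (c x)‖ := norm_le_norm_add_norm_sub _ _
    exact mem_closedBall_zero_iff.2 (hle.trans (mul_le_mul_of_nonneg_left (by linarith) K.2))
  refine (isCompact_closedBall _ _).tendsto_nhds_of_unique_mapClusterPt hbound fun v _ hv =>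
    huniq v fun w => ?_
  obtain ⟨U, hU, hUv⟩ := mapClusterPt_iff_ultrafilter.1 hv
  have hfU : Tendsto f U (𝓝 (f x₀)) := hf.tendsto.mono_left hU
  exact le_of_tendsto_of_tendsto' (hfU.sub ((hTc.tendsto v).comp hUv)).norm
    (hfU.sub tendsto_const_nhds).norm fun x => hmin x w

variable (n : ℕ)

/-- The vector of the coefficients `c_0(α), …, c_n(α)` of the minimax polynomial. -/
def coeffs (α : ℝ) : Fin (n + 1) → ℝ := toFn (n + 1) (minimaxPoly n α)

theorem ofFn_coeffs (α : ℝ) : ofFn (n + 1) (coeffs n α) = minimaxPoly n α :=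
  ofFn_comp_toFn_eq_id_of_natDegree_lt
    (Nat.lt_succ_of_le (minimaxPoly_isMinimax n α).natDegree_le)

theorem natDegree_ofFn_succ_le {n : ℕ} (c : Fin (n + 1) → ℝ) : (ofFn (n + 1) c).natDegree ≤ n :=
  Nat.le_of_lt_succ (ofFn_natDegree_lt n.succ_pos c)

/-- The map sending a vector of coefficients to the polynomial function on `[-1, 1]`. -/
def polyMap : (Fin (n + 1) → ℝ) →ₗ[ℝ] C(Icc (-1 : ℝ) 1, ℝ) :=
  (toContinuousMapOnAlgHom (R := ℝ) (Icc (-1 : ℝ) 1)).toLinearMap ∘ₗ ofFn (n + 1)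

theorem polyMap_injective : Function.Injective (polyMap n) := by
  intro c d hcd
  refine injective_ofFn (n + 1) (eq_of_infinite_eval_eq _ _
    ((Icc_infinite (show (-1 : ℝ) < 1 by norm_num)).mono fun x hx => ?_))
  exact congrArg (fun f : C(Icc (-1 : ℝ) 1, ℝ) => f ⟨x, hx⟩) hcd

theorem norm_checkmark_sub_polyMap (α : ℝ) (c : Fin (n + 1) → ℝ) :
    ‖checkmark α - polyMap n c‖ = maxErr α (ofFn (n + 1) c) := rfl

theorem continuousAt_coeffs {α₀ : ℝ} (hα₀ : α₀ ∈ Ioo (-1 : ℝ) 1) :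
    ContinuousAt (coeffs n) α₀ := by
  refine continuousAt_of_forall_norm_sub_le (polyMap_injective n)
    continuous_checkmark.continuousAt (fun α c => ?_) fun c hc => injective_ofFn (n + 1) ?_
  · simpa only [norm_checkmark_sub_polyMap, ofFn_coeffs] using
      (minimaxPoly_isMinimax n α).maxErr_le (natDegree_ofFn_succ_le c)
  · have hcoeffs := hc (coeffs n α₀)
    simp only [norm_checkmark_sub_polyMap, ofFn_coeffs] at hcoeffs
    have hmin : IsMinimax n α₀ (ofFn (n + 1) c) :=
      ⟨mem_degreeLE_iff.2 (natDegree_ofFn_succ_le c), fun q hq =>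
        hcoeffs.trans ((minimaxPoly_isMinimax n α₀).2 q hq)⟩
    rw [ofFn_coeffs]
    exact ((minimaxPoly_isMinimax n α₀).unique hmin (minimaxError_pos n hα₀)).symm

theorem contDiff_eval_map_ofFn (N : ℕ) (D : ℝ[X] →ₗ[ℝ] ℝ[X]) :
    ContDiff ℝ ω fun w : (Fin N → ℝ) × ℝ => (D (ofFn N w.1)).eval w.2 := by
  have hsum (w : (Fin N → ℝ) × ℝ) :
      (D (ofFn N w.1)).eval w.2 = ∑ j, w.1 j * (D (X ^ (j : ℕ))).eval w.2 := by
    simp only [ofFn_eq_sum_monomial, map_sum, eval_finsetSum, ← smul_X_eq_monomial, map_smul,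
      eval_smul, smul_eq_mul]
  simp only [hsum]
  exact ContDiff.sum fun j _ => ((contDiff_apply ℝ ℝ j).comp contDiff_fst).mul
    ((AnalyticOnNhd.eval_polynomial _).contDiff.comp contDiff_snd)

theorem tendsto_eval_map_minimaxPoly {α₀ : ℝ} (hα₀ : α₀ ∈ Ioo (-1 : ℝ) 1)
    (D : ℝ[X] →ₗ[ℝ] ℝ[X]) (x : ℝ) :
    Tendsto (fun w : ℝ × ℝ => (D (minimaxPoly n w.1)).eval w.2) (𝓝 (α₀, x))
      (𝓝 ((D (minimaxPoly n α₀)).eval x)) := by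
  have hpair : Tendsto (fun w : ℝ × ℝ => (coeffs n w.1, w.2)) (𝓝 (α₀, x))
      (𝓝 (coeffs n α₀, x)) :=
    ((continuousAt_coeffs n hα₀).tendsto.comp (continuous_fst.tendsto (α₀, x))).prodMk_nhds
      (continuous_snd.tendsto (α₀, x))
  simpa only [Function.comp_def, ofFn_coeffs] using
    ((contDiff_eval_map_ofFn (n + 1) D).continuous.tendsto _).comp hpair

theorem tendsto_err_minimaxPoly {α₀ : ℝ} (hα₀ : α₀ ∈ Ioo (-1 : ℝ) 1) (x : ℝ) :
    Tendsto (fun w : ℝ × ℝ => err w.1 (minimaxPoly n w.1) w.2) (𝓝 (α₀, x))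
      (𝓝 (err α₀ (minimaxPoly n α₀) x)) :=
  (show Continuous fun w : ℝ × ℝ => |w.2 - w.1| by fun_prop).continuousAt.tendsto.sub
    (tendsto_eval_map_minimaxPoly n hα₀ LinearMap.id x)

end Coefficients

section System

theorem analyticAt_of_implicit {F G : Type*} [NormedAddCommGroup F] [NormedSpace ℝ F]
    [FiniteDimensional ℝ F] [NormedAddCommGroup G] [NormedSpace ℝ G] [FiniteDimensional ℝ G]
    (hdim : Module.finrank ℝ F = Module.finrank ℝ G) {Φ : ℝ × F → G} {u : ℝ → F} {a : ℝ}
    (hΦ : ContDiffAt ℝ ω Φ (a, u a)) (hinj : ∀ v, fderiv ℝ Φ (a, u a) (0, v) = 0 → v = 0)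
    (hu : ContinuousAt u a) (h0 : ∀ᶠ x in 𝓝 a, Φ (x, u x) = 0) : AnalyticAt ℝ u a := by
  have : CompleteSpace F := FiniteDimensional.complete ℝ F
  have : CompleteSpace G := FiniteDimensional.complete ℝ G
  let L : F →L[ℝ] G := fderiv ℝ Φ (a, u a) ∘L ContinuousLinearMap.inr ℝ ℝ F
  have hL : Function.Injective L.toLinearMap := (injective_iff_map_eq_zero L.toLinearMap).2 hinj
  have hinv : L.IsInvertible :=
    ⟨(LinearEquiv.ofInjectiveOfFinrankEq L.toLinearMap hL hdim).toContinuousLinearEquiv, by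
      ext v; rfl⟩
  have hω : (ω : WithTop ℕ∞) ≠ 0 := by simp
  refine (hΦ.contDiffAt_implicitFunction hω hinv).analyticAt.congr ?_
  have hgraph : Tendsto (fun x => (x, u x)) (𝓝 a) (𝓝 (a, u a)) := tendsto_id.prodMk_nhds hu
  filter_upwards [hgraph.eventually (hΦ.eventually_apply_eq_iff_implicitFunction hω hinv), h0]
    with x hx hx0
  exact hx.1 (hx0.trans h0.self_of_nhds.symm)

variable {n : ℕ} {α₀ : ℝ}

/-- The equation `pointEq α₀ x α p y = 0` singles out the extremal point `y` of the error near an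
extremal point `x` when the corner is `α` near `α₀`: the endpoints `±1` stay fixed, the corner
moves along, and all other extremal points are critical. -/
def pointEq (α₀ x α : ℝ) (p : ℝ[X]) (y : ℝ) : ℝ :=
  if x = -1 ∨ x = 1 then y - x else if x = α₀ then y - α
    else SignType.sign (x - α₀) - p.derivative.eval y

/-- The equations satisfied by the corner `α`, the coefficients of the minimax polynomial, the
error at the first point and the points of an alternation near `z`, the latter being an alternation
for the corner `α₀`. Replacing `|y - α|` by `sign (x - α₀) * (y - α)` makes them analytic. -/
def system (n : ℕ) (α₀ : ℝ) (z : Fin (n + 2) → ℝ)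
    (w : ℝ × (Fin (n + 1) → ℝ) × ℝ × (Fin (n + 2) → ℝ)) :
    (Fin (n + 2) → ℝ) × (Fin (n + 2) → ℝ) :=
  (fun i => SignType.sign (z i - α₀) * (w.2.2.2 i - w.1) - (ofFn (n + 1) w.2.1).eval (w.2.2.2 i) -
      (-1) ^ (i : ℕ) * w.2.2.1,
    fun i => pointEq α₀ (z i) w.1 (ofFn (n + 1) w.2.1) (w.2.2.2 i))

theorem contDiff_system (n : ℕ) (α₀ : ℝ) (z : Fin (n + 2) → ℝ) :
    ContDiff ℝ ω (system n α₀ z) := by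
  have hpoint (i : Fin (n + 2)) : ContDiff ℝ ω
      fun w : ℝ × (Fin (n + 1) → ℝ) × ℝ × (Fin (n + 2) → ℝ) => w.2.2.2 i :=
    (contDiff_apply ℝ ℝ i).comp contDiff_snd.snd.snd
  have heval (D : ℝ[X] →ₗ[ℝ] ℝ[X]) (i : Fin (n + 2)) : ContDiff ℝ ω
      fun w : ℝ × (Fin (n + 1) → ℝ) × ℝ × (Fin (n + 2) → ℝ) =>
        (D (ofFn (n + 1) w.2.1)).eval (w.2.2.2 i) :=
    (contDiff_eval_map_ofFn (n + 1) D).comp (contDiff_snd.fst.prodMk (hpoint i))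
  refine ContDiff.prodMk (contDiff_pi.2 fun i => ?_) (contDiff_pi.2 fun i => ?_)
  · exact ((contDiff_const.mul ((hpoint i).sub contDiff_fst)).sub (heval LinearMap.id i)).sub
      (contDiff_const.mul contDiff_snd.snd.fst)
  · unfold pointEq
    split_ifs
    · exact (hpoint i).sub contDiff_const
    · exact (hpoint i).sub contDiff_fst
    · exact contDiff_const.sub (heval derivative i)

theorem hasDerivAt_add_mul (x v : ℝ) : HasDerivAt (fun t : ℝ => x + t * v) v 0 := by
  simpa using ((hasDerivAt_id (0 : ℝ)).mul_const v).const_add x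

theorem hasDerivAt_eval_add_smul (p q : ℝ[X]) (y v : ℝ) :
    HasDerivAt (fun t : ℝ => (p + t • q).eval (y + t * v))
      (p.derivative.eval y * v + q.eval y) 0 := by
  have hp := (p.hasDerivAt y).comp_of_eq 0 (hasDerivAt_add_mul y v) (by simp)
  have hq := (q.hasDerivAt y).comp_of_eq 0 (hasDerivAt_add_mul y v) (by simp)
  simpa [Function.comp_def] using hp.fun_add ((hasDerivAt_id' (0 : ℝ)).fun_mul hq)

theorem hasDerivAt_pointEq_add_smul (α₀ x : ℝ) (p q : ℝ[X]) (v : ℝ) :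
    HasDerivAt (fun t : ℝ => pointEq α₀ x α₀ (p + t • q) (x + t * v))
      (if x = -1 ∨ x = 1 ∨ x = α₀ then v
        else -(p.derivative.derivative.eval x * v + q.derivative.eval x)) 0 := by
  by_cases hend : x = -1 ∨ x = 1
  · simpa only [pointEq, if_pos hend, ← or_assoc, if_pos (Or.inl hend : _ ∨ x = α₀)] using
      (hasDerivAt_add_mul x v).sub_const x
  by_cases hcorner : x = α₀
  · simpa only [pointEq, if_neg hend, if_pos hcorner, ← or_assoc,
      if_pos (Or.inr hcorner : _ ∨ x = α₀)] using (hasDerivAt_add_mul x v).sub_const α₀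
  · simp only [pointEq, ← or_assoc, or_self, derivative_add, derivative_smul, hend, hcorner,
      if_false]
    exact (hasDerivAt_eval_add_smul p.derivative q.derivative x v).const_sub _

theorem hasDerivAt_system_add_smul (z : Fin (n + 2) → ℝ) (c d : Fin (n + 1) → ℝ) (h η : ℝ)
    (ζ : Fin (n + 2) → ℝ) :
    HasDerivAt (fun t : ℝ => system n α₀ z ((α₀, c, h, z) + t • (0, d, η, ζ)))
      (fun i => SignType.sign (z i - α₀) * ζ i -
          ((ofFn (n + 1) c).derivative.eval (z i) * ζ i + (ofFn (n + 1) d).eval (z i)) -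
          (-1) ^ (i : ℕ) * η,
        fun i => if z i = -1 ∨ z i = 1 ∨ z i = α₀ then ζ i
          else -((ofFn (n + 1) c).derivative.derivative.eval (z i) * ζ i +
            (ofFn (n + 1) d).derivative.eval (z i))) 0 := by
  refine HasDerivAt.prodMk (hasDerivAt_pi.2 fun i => ?_) (hasDerivAt_pi.2 fun i => ?_)
  · simpa using ((((hasDerivAt_add_mul (z i) (ζ i)).sub_const α₀).const_mul
      (SignType.sign (z i - α₀) : ℝ)).fun_sub
        (hasDerivAt_eval_add_smul (ofFn (n + 1) c) (ofFn (n + 1) d) (z i) (ζ i))).fun_sub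
          ((hasDerivAt_add_mul h η).const_mul ((-1) ^ (i : ℕ)))
  · simpa using hasDerivAt_pointEq_add_smul α₀ (z i) (ofFn (n + 1) c) (ofFn (n + 1) d) (ζ i)

theorem eq_zero_of_eval_eq_neg_one_pow_mul {q : ℝ[X]} {η : ℝ} {z : Fin (n + 2) → ℝ}
    (hq : q.natDegree ≤ n) (hz : StrictMono z) (h : ∀ i, q.eval (z i) = (-1) ^ (i : ℕ) * η) :
    q = 0 ∧ η = 0 := by
  have hη : η = 0 := by
    obtain ⟨i, hi⟩ := exists_eval_mul_eval_nonneg hq hz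
    have hprod : q.eval (z i.castSucc) * q.eval (z i.succ) = -η ^ 2 := by
      have hsq : ((-1 : ℝ) ^ (i : ℕ)) ^ 2 = 1 := by rw [← pow_mul, pow_mul', neg_one_sq, one_pow]
      rw [h, h, Fin.val_castSucc, Fin.val_succ, pow_succ]
      linear_combination -η ^ 2 * hsq
    exact pow_eq_zero_iff two_ne_zero |>.1 (le_antisymm (by linarith) (sq_nonneg η))
  refine ⟨eq_zero_of_natDegree_lt_card_of_eval_eq_zero q hz.injective (fun i => ?_) ?_, hη⟩
  · rw [h, hη, mul_zero]
  · rw [Fintype.card_fin]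
    lia

end System

section Regular

variable {n : ℕ} {α α₀ x : ℝ} {p : ℝ[X]} {z : Fin (n + 2) → ℝ}

/-- The nondegenerate corners: the error has exactly `n + 2` extremal points, its one-sided
derivatives do not vanish at the endpoints and at the corner, and its second derivative does not
vanish at the critical extremal points. -/
structure Regular (n : ℕ) (α₀ : ℝ) : Prop where
  card_extr : (extr α₀ (minimaxPoly n α₀) (minimaxError n α₀)).card = n + 2
  left : (minimaxPoly n α₀).derivative.eval (-1) ≠ -1
  right : (minimaxPoly n α₀).derivative.eval 1 ≠ 1
  corner : (minimaxPoly n α₀).derivative.eval α₀ ≠ 1 ∧ (minimaxPoly n α₀).derivative.eval α₀ ≠ -1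
  nondegenerate : ∀ x ∈ Ioo (-1 : ℝ) 1, x ≠ α₀ →
    |err α₀ (minimaxPoly n α₀) x| = minimaxError n α₀ →
      (minimaxPoly n α₀).derivative.derivative.eval x ≠ 0

theorem IsCrit.sign_sub (h : IsCrit α p x) : SignType.sign (x - α) = p.derivative.eval x := by
  rcases h with ⟨hx, hp⟩ | ⟨hx, hp⟩
  · simp [sign_neg (sub_neg.2 hx), hp]
  · simp [sign_pos (sub_pos.2 hx), hp]

theorem mem_Ioo_of_mem_Icc_of_ne {a b x : ℝ} (hx : x ∈ Icc a b) (h : ¬ (x = a ∨ x = b)) :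
    x ∈ Ioo a b :=
  ⟨hx.1.lt_of_ne fun ha => h (Or.inl ha.symm), hx.2.lt_of_ne fun hb => h (Or.inr hb)⟩

theorem Regular.fderiv_system_injective (hR : Regular n α₀) (hα₀ : α₀ ∈ Ioo (-1 : ℝ) 1)
    (hz : Alternates (err α₀ (minimaxPoly n α₀)) (Icc (-1) 1) (minimaxError n α₀) z) (h : ℝ)
    (v : (Fin (n + 1) → ℝ) × ℝ × (Fin (n + 2) → ℝ))
    (hv : fderiv ℝ (system n α₀ z) (α₀, coeffs n α₀, h, z) (0, v) = 0) : v = 0 := by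
  obtain ⟨d, η, ζ⟩ := v
  have hline := (((contDiff_system n α₀ z).differentiable (by simp)).differentiableAt
    (x := (α₀, coeffs n α₀, h, z))).hasFDerivAt.hasLineDerivAt (0, d, η, ζ)
  have heq := (hasDerivAt_system_add_smul z (coeffs n α₀) d h η ζ).unique hline
  rw [hv, ofFn_coeffs, Prod.mk_eq_zero] at heq
  have hE := fun i => hz.abs_eq (minimaxError_pos n hα₀).le i
  have hvalue (i : Fin (n + 2)) : (ofFn (n + 1) d).eval (z i) = (-1) ^ (i : ℕ) * -η := by
    have hi := congrFun heq.1 i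
    suffices (SignType.sign (z i - α₀) - (minimaxPoly n α₀).derivative.eval (z i)) * ζ i = 0 by
      simp only [Pi.zero_apply] at hi
      linarith
    by_cases hfixed : z i = -1 ∨ z i = 1 ∨ z i = α₀
    · have hζ := congrFun heq.2 i
      simp only [if_pos hfixed, Pi.zero_apply] at hζ
      rw [hζ, mul_zero]
    · rw [← or_assoc, not_or] at hfixed
      have hcrit := (equioscillates_minimaxPoly n hα₀).isCrit
        (mem_Ioo_of_mem_Icc_of_ne (hz.mem i) hfixed.1) hfixed.2 (hE i)
      rw [hcrit.sign_sub, sub_self, zero_mul]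
  obtain ⟨hd, hη⟩ := eq_zero_of_eval_eq_neg_one_pow_mul (natDegree_ofFn_succ_le d) hz.strictMono
    hvalue
  have hζ (i : Fin (n + 2)) : ζ i = 0 := by
    have hi := congrFun heq.2 i
    by_cases hfixed : z i = -1 ∨ z i = 1 ∨ z i = α₀
    · simpa only [if_pos hfixed, Pi.zero_apply] using hi
    · simp only [if_neg hfixed, hd, derivative_zero, eval_zero, add_zero, Pi.zero_apply,
        neg_eq_zero, mul_eq_zero] at hi
      rw [← or_assoc, not_or] at hfixed
      exact hi.resolve_left (hR.nondegenerate _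
        (mem_Ioo_of_mem_Icc_of_ne (hz.mem i) hfixed.1) hfixed.2 (hE i))
  rw [injective_ofFn (n + 1) (hd.trans (map_zero _).symm), neg_eq_zero.1 hη, funext hζ]
  rfl

end Regular

section Localization

variable {n : ℕ} {α₀ x δ : ℝ}

/-- The points of `[-1, 1]` at which the minimax error is attained, whatever the sign. -/
def extremalSet (n : ℕ) (α : ℝ) : Set ℝ :=
  {x ∈ Icc (-1 : ℝ) 1 | |err α (minimaxPoly n α) x| = minimaxError n α}

theorem eventually_sign_eq {X : Type*} {l : Filter X} {u : X → ℝ} {a : ℝ}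
    (hu : Tendsto u l (𝓝 a)) (ha : a ≠ 0) :
    ∀ᶠ t in l, SignType.sign (u t) = SignType.sign a :=
  hu.eventually ((continuousAt_sign_of_ne_zero ha).eventually
    ((isOpen_discrete {SignType.sign a}).mem_nhds rfl))

theorem eventually_forall_mem_ball {X Y : Type*} [TopologicalSpace X] [PseudoMetricSpace Y]
    {P : X × Y → Prop} {a : X} {x : Y} (h : ∀ᶠ w in 𝓝 (a, x), P w) :
    ∀ᶠ δ in 𝓝[>] (0 : ℝ), ∀ᶠ b in 𝓝 a, ∀ y ∈ Metric.ball x δ, P (b, y) := by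
  rw [nhds_prod_eq, eventually_prod_iff] at h
  obtain ⟨pa, ha, pb, hb, hab⟩ := h
  obtain ⟨ε, hε, hball⟩ := Metric.eventually_nhds_iff_ball.1 hb
  filter_upwards [Ioc_mem_nhdsGT hε] with δ hδ
  exact ha.mono fun b hpa y hy => hab hpa (hball y (Metric.ball_subset_ball hδ.2 hy))

theorem injOn_eval_of_derivative_ne_zero {p : ℝ[X]} {s : Set ℝ} (hs : s.OrdConnected)
    (h : ∀ y ∈ s, p.derivative.eval y ≠ 0) : InjOn (fun y => p.eval y) s := by
  have hlt : ∀ y ∈ s, ∀ y' ∈ s, y < y' → p.eval y ≠ p.eval y' := fun y hy y' hy' hyy' heq => by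
    obtain ⟨t, ht, ht0⟩ := exists_hasDerivAt_eq_zero hyy' p.continuous.continuousOn heq
      fun t _ => p.hasDerivAt t
    exact h t (hs.out hy hy' (Ioo_subset_Icc_self ht)) ht0
  intro y hy y' hy' heq
  by_contra hne
  rcases lt_or_gt_of_ne hne with hyy' | hyy'
  · exact hlt y hy y' hy' hyy' heq
  · exact hlt y' hy' y hy hyy' heq.symm

theorem eventually_sign_eq_derivative (n : ℕ) (hα₀ : α₀ ∈ Ioo (-1 : ℝ) 1) (hx : x ≠ α₀) :
    ∀ᶠ w : ℝ × ℝ in 𝓝 (α₀, x), w.2 ∈ extremalSet n w.1 → w.2 ∈ Ioo (-1 : ℝ) 1 →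
      SignType.sign (x - α₀) = (minimaxPoly n w.1).derivative.eval w.2 := by
  have hsub : ContinuousAt (fun w : ℝ × ℝ => w.2 - w.1) (α₀, x) := by fun_prop
  filter_upwards [continuousAt_fst.eventually (isOpen_Ioo.mem_nhds hα₀),
    eventually_sign_eq hsub.tendsto (sub_ne_zero.2 hx)] with w hw hsign hext hmem
  have hne : w.2 ≠ w.1 := by
    rw [← sub_ne_zero, ← sign_ne_zero, hsign, sign_ne_zero]
    exact sub_ne_zero.2 hx
  rw [← hsign]
  exact ((equioscillates_minimaxPoly n hw).isCrit hmem hne hext.2).sign_sub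

theorem Regular.derivative_ne_sign (hR : Regular n α₀) (hα₀ : α₀ ∈ Ioo (-1 : ℝ) 1)
    (hx : x = -1 ∨ x = 1) :
    (minimaxPoly n α₀).derivative.eval x ≠ SignType.sign (x - α₀) := by
  rcases hx with rfl | rfl
  · simpa [sign_neg (sub_neg.2 hα₀.1)] using hR.left
  · simpa [sign_pos (sub_pos.2 hα₀.2)] using hR.right

theorem Regular.eventually_pointEq (hR : Regular n α₀) (hα₀ : α₀ ∈ Ioo (-1 : ℝ) 1)
    (hx : x ∈ Icc (-1 : ℝ) 1) :
    ∀ᶠ w : ℝ × ℝ in 𝓝 (α₀, x), w.2 ∈ extremalSet n w.1 →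
      pointEq α₀ x w.1 (minimaxPoly n w.1) w.2 = 0 := by
  have hderiv := tendsto_eval_map_minimaxPoly n hα₀ derivative x
  have hsnd : ContinuousAt (fun w : ℝ × ℝ => w.2) (α₀, x) := continuousAt_snd
  by_cases hend : x = -1 ∨ x = 1
  · simp only [pointEq, if_pos hend]
    have hxα : x ≠ α₀ := by rcases hend with rfl | rfl; exacts [hα₀.1.ne, hα₀.2.ne']
    have hx0 : x ≠ -x := by rcases hend with rfl | rfl <;> norm_num
    filter_upwards [eventually_sign_eq_derivative n hα₀ hxα, hsnd.eventually_ne hx0,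
      hderiv.eventually_ne (hR.derivative_ne_sign hα₀ hend)] with w hsign hneg hne hext
    by_contra h0
    refine hne (hsign hext (mem_Ioo_of_mem_Icc_of_ne hext.1 ?_)).symm
    rcases hend with rfl | rfl <;> grind
  have hmem := hsnd.eventually (isOpen_Ioo.mem_nhds (mem_Ioo_of_mem_Icc_of_ne hx hend))
  by_cases hcorner : x = α₀
  · simp only [pointEq, if_neg hend, if_pos hcorner]
    subst hcorner
    filter_upwards [continuousAt_fst.eventually (isOpen_Ioo.mem_nhds hα₀), hmem,
      hderiv.eventually_ne hR.corner.1, hderiv.eventually_ne hR.corner.2]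
      with w hw hwI hone hneg_one hext
    by_contra hne
    rcases (equioscillates_minimaxPoly n hw).isCrit hwI (sub_ne_zero.1 hne) hext.2 with hc | hc
    exacts [hneg_one hc.2, hone hc.2]
  · simp only [pointEq, if_neg hend, if_neg hcorner]
    filter_upwards [eventually_sign_eq_derivative n hα₀ hcorner, hmem] with w hsign hwI hext
    exact sub_eq_zero.2 (hsign hext hwI)

theorem Regular.eventually_injOn_pointEq (hR : Regular n α₀) (hα₀ : α₀ ∈ Ioo (-1 : ℝ) 1)
    (hx : x ∈ extremalSet n α₀) :
    ∀ᶠ δ in 𝓝[>] (0 : ℝ), ∀ᶠ α in 𝓝 α₀,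
      InjOn (pointEq α₀ x α (minimaxPoly n α)) (Metric.ball x δ) := by
  by_cases hend : x = -1 ∨ x = 1
  · simp only [InjOn, pointEq, if_pos hend, sub_left_inj, imp_self, implies_true,
      eventually_true]
  by_cases hcorner : x = α₀
  · simp only [InjOn, pointEq, if_neg hend, if_pos hcorner, sub_left_inj, imp_self, implies_true,
      eventually_true]
  have hne := hR.nondegenerate x (mem_Ioo_of_mem_Icc_of_ne hx.1 hend) hcorner hx.2
  filter_upwards [eventually_forall_mem_ball ((tendsto_eval_map_minimaxPoly n hα₀
    (derivative ∘ₗ derivative) x).eventually_ne hne)] with δ hδ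
  filter_upwards [hδ] with α hα y hy y' hy' heq
  simp only [pointEq, if_neg hend, if_neg hcorner, sub_right_inj] at heq
  exact injOn_eval_of_derivative_ne_zero (convex_ball x δ).ordConnected hα hy hy' heq

theorem Regular.eventually_subsingleton (hR : Regular n α₀) (hα₀ : α₀ ∈ Ioo (-1 : ℝ) 1)
    (hx : x ∈ extremalSet n α₀) :
    ∀ᶠ δ in 𝓝[>] (0 : ℝ), ∀ᶠ α in 𝓝 α₀, (extremalSet n α ∩ Metric.ball x δ).Subsingleton := by
  filter_upwards [eventually_forall_mem_ball (hR.eventually_pointEq hα₀ hx.1),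
    hR.eventually_injOn_pointEq hα₀ hx] with δ hδ hδ'
  filter_upwards [hδ, hδ'] with α hzero hinj y hy y' hy'
  exact hinj hy.2 hy'.2 ((hzero y hy.2 hy.1).trans (hzero y' hy'.2 hy'.1).symm)

theorem eventually_extremalSet_subset (n : ℕ) (hα₀ : α₀ ∈ Ioo (-1 : ℝ) 1) (hδ : 0 < δ) :
    ∀ᶠ α in 𝓝 α₀, extremalSet n α ⊆ Metric.thickening δ (extremalSet n α₀) := by
  have hlt : ∀ᶠ α in 𝓝 α₀, ∀ y ∈ Icc (-1 : ℝ) 1 \ Metric.thickening δ (extremalSet n α₀),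
      |err α (minimaxPoly n α) y| < minimaxError n α := by
    refine (isCompact_Icc.diff Metric.isOpen_thickening).eventually_forall_of_forall_eventually
      fun y hy => ?_
    refine (tendsto_err_minimaxPoly n hα₀ y).abs.eventually_lt
      (((continuous_minimaxError n).comp continuous_fst).tendsto (α₀, y))
      (((equioscillates_minimaxPoly n hα₀).abs_err_le y hy.1).lt_of_ne fun heq => hy.2 ?_)
    exact Metric.self_subset_thickening hδ _ ⟨hy.1, heq⟩
  filter_upwards [hlt] with α hα y hy
  by_contra hnot
  exact (hα y ⟨hy.1, hnot⟩).ne hy.2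

theorem eventually_add_le_sub {N : ℕ} {z : Fin N → ℝ} (hz : StrictMono z) :
    ∀ᶠ δ in 𝓝[>] (0 : ℝ), ∀ i j, i < j → z i + δ ≤ z j - δ := by
  refine eventually_all.2 fun i => eventually_all.2 fun j => ?_
  by_cases hij : i < j
  · filter_upwards [Ioc_mem_nhdsGT (half_pos (sub_pos.2 (hz hij)))] with δ hδ _
    linarith [hδ.2]
  · exact .of_forall fun δ h => absurd h hij

theorem dist_lt_and_eq_range {N : ℕ} {S : Set ℝ} {y z : Fin N → ℝ} (hy : StrictMono y)
    (hyS : ∀ i, y i ∈ S) (hz : ∀ i j, i < j → z i + δ ≤ z j - δ)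
    (hS : S ⊆ Metric.thickening δ (range z)) (hsub : ∀ i, (S ∩ Metric.ball (z i) δ).Subsingleton) :
    (∀ i, dist (y i) (z i) < δ) ∧ S = range y := by
  have hball : ∀ s ∈ S, ∃ j, dist s (z j) < δ := fun s hs => by
    simpa [Metric.mem_thickening_iff] using hS hs
  choose j hj using fun i => hball (y i) (hyS i)
  have hj_mono : StrictMono j := fun a b hab => by
    by_contra! hba
    rcases hba.eq_or_lt with heq | hlt
    · exact (hy hab).ne (hsub (j a) ⟨hyS a, hj a⟩ ⟨hyS b, heq ▸ hj b⟩)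
    · have ha := abs_lt.1 (hj a)
      have hb := abs_lt.1 (hj b)
      linarith [hz _ _ hlt, hy hab]
  have hj_id : j = id := (StrictMono.range_inj hj_mono strictMono_id).1 <| by
    rw [range_id, (Finite.injective_iff_surjective.1 hj_mono.injective).range_eq]
  rw [hj_id] at hj
  refine ⟨hj, Subset.antisymm (fun s hs => ?_) (range_subset_iff.2 hyS)⟩
  obtain ⟨i, hi⟩ := hball s hs
  exact ⟨i, hsub i ⟨hyS i, hj i⟩ ⟨hs, hi⟩⟩

variable {z : Fin (n + 2) → ℝ}

theorem Regular.extremalSet_eq_range (hR : Regular n α₀) (hα₀ : α₀ ∈ Ioo (-1 : ℝ) 1)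
    (hz : Alternates (err α₀ (minimaxPoly n α₀)) (Icc (-1) 1) (minimaxError n α₀) z) :
    extremalSet n α₀ = range z := by
  have h := equioscillates_minimaxPoly n hα₀
  have himage : Finset.univ.image z = extr α₀ (minimaxPoly n α₀) (minimaxError n α₀) := by
    refine Finset.eq_of_subset_of_card_le (Finset.image_subset_iff.2 fun i _ =>
      h.alternates_mem_extr hz i) ?_
    rw [hR.card_extr, Finset.card_image_of_injective _ hz.strictMono.injective, Finset.card_univ,
      Fintype.card_fin]
  ext x
  rw [← Fintype.coe_image_univ, himage]
  exact h.mem_extr.symm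

theorem Regular.eventually_alternates (hR : Regular n α₀) (hα₀ : α₀ ∈ Ioo (-1 : ℝ) 1)
    (hz : Alternates (err α₀ (minimaxPoly n α₀)) (Icc (-1) 1) (minimaxError n α₀) z) {r : ℝ}
    (hr : 0 < r) :
    ∀ᶠ α in 𝓝 α₀, ∀ y : Fin (n + 2) → ℝ,
      Alternates (err α (minimaxPoly n α)) (Icc (-1) 1) (minimaxError n α) y →
        (∀ i, dist (y i) (z i) < r) ∧ extremalSet n α = range y := by
  have hrange := hR.extremalSet_eq_range hα₀ hz
  have hsingle : ∀ᶠ δ in 𝓝[>] (0 : ℝ), ∀ i, ∀ᶠ α in 𝓝 α₀,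
      (extremalSet n α ∩ Metric.ball (z i) δ).Subsingleton :=
    eventually_all.2 fun i => hR.eventually_subsingleton hα₀ (hrange ▸ mem_range_self i)
  have hsmall : ∀ᶠ δ in 𝓝[>] (0 : ℝ), δ ∈ Ioc 0 r := Ioc_mem_nhdsGT hr
  obtain ⟨δ, hδ, hsingle, hsep⟩ :=
    (hsmall.and (hsingle.and (eventually_add_le_sub hz.strictMono))).exists
  filter_upwards [isOpen_Ioo.mem_nhds hα₀, eventually_all.2 hsingle,
    eventually_extremalSet_subset n hα₀ hδ.1] with α hα hsub hthick y hy
  have hextremal (i : Fin (n + 2)) : y i ∈ extremalSet n α :=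
    ⟨hy.mem i, hy.abs_eq (minimaxError_pos n hα).le i⟩
  obtain ⟨hdist, heq⟩ :=
    dist_lt_and_eq_range hy.strictMono hextremal hsep (hrange ▸ hthick) hsub
  exact ⟨fun i => (hdist i).trans_le hδ.2, heq⟩

end Localization

section Analyticity

variable {n : ℕ} {α α₀ : ℝ}

theorem regular_of_forall_isVShape_ne (hα₀ : α₀ ∈ Ioo (-1 : ℝ) 1)
    (hV : ∀ a b c : ℝ, IsVShape (minimaxError n) a b c → α₀ ≠ a ∧ α₀ ≠ b ∧ α₀ ≠ c) :
    Regular n α₀ := by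
  have h := equioscillates_minimaxPoly n hα₀
  have hextr : (extr α₀ (minimaxPoly n α₀) (minimaxError n α₀)).card = n + 2 := by
    refine le_antisymm (not_lt.1 fun hlt => ?_) h.le_card_extr
    obtain ⟨a, c, hVOn⟩ := h.exists_isVOn_of_card hα₀ hlt
    obtain ⟨a', c', -, -, hVShape⟩ := hVOn.exists_isVShape (continuous_minimaxError n)
    exact (hV _ _ _ hVShape).2.1 rfl
  have hright : 1 ∉ crit α₀ (minimaxPoly n α₀) := fun h1 => by
    obtain ⟨a, b, hVShape⟩ := h.exists_isVShape_of_one_mem_crit hα₀ h1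
    exact (hV _ _ _ hVShape).2.2 rfl
  have hleft : -1 ∉ crit α₀ (minimaxPoly n α₀) := fun h1 => by
    obtain ⟨b, c, hVShape⟩ := h.exists_isVShape_of_neg_one_mem_crit hα₀ h1
    exact (hV _ _ _ hVShape).1 rfl
  have hcrit : n ≤ (crit α₀ (minimaxPoly n α₀)).card + 1 := by
    have := card_extr_le_card_crit_add_three α₀ (minimaxError n α₀) (minimaxPoly n α₀)
    omega
  exact
    { card_extr := hextr
      left := fun h1 => hleft (h.mem_crit.2 (Or.inl ⟨hα₀.1, h1⟩))
      right := fun h1 => hright (h.mem_crit.2 (Or.inr ⟨hα₀.2, h1⟩))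
      corner := ⟨h.derivative_corner_ne_one hα₀ hcrit, h.derivative_corner_ne_neg_one hα₀ hcrit⟩
      nondegenerate := fun _ hx hxα hxE =>
        h.derivative_derivative_ne_zero_of_abs_eq hx hxα hxE hcrit }

theorem sign_mul_sub_eq_abs_of_pointEq {x y : ℝ} {p : ℝ[X]} (hα₀ : α₀ ∈ Ioo (-1 : ℝ) 1)
    (hsign : x ≠ α₀ → SignType.sign (y - α) = SignType.sign (x - α₀))
    (hpoint : pointEq α₀ x α p y = 0) : SignType.sign (x - α₀) * (y - α) = |y - α| := by
  rcases eq_or_ne x α₀ with rfl | hx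
  · have hend : ¬ (x = -1 ∨ x = 1) := by
      rintro (rfl | rfl)
      exacts [hα₀.1.ne rfl, hα₀.2.ne rfl]
    rw [pointEq, if_neg hend, if_pos rfl] at hpoint
    rw [hpoint, mul_zero, abs_zero]
  · rw [← hsign hx, sign_mul_self]

theorem Alternates.system_eq_zero {y z : Fin (n + 2) → ℝ}
    (hy : Alternates (err α (minimaxPoly n α)) (Icc (-1) 1) (minimaxError n α) y)
    (hsign : ∀ i, SignType.sign (z i - α₀) * (y i - α) = |y i - α|)
    (hpoint : ∀ i, pointEq α₀ (z i) α (minimaxPoly n α) (y i) = 0) :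
    system n α₀ z (α, coeffs n α, err α (minimaxPoly n α) (y 0), y) = 0 := by
  refine Prod.ext (funext fun i => ?_) (funext fun i => ?_)
  · simp only [system, ofFn_coeffs, hsign]
    exact sub_eq_zero.2 (eq_neg_one_pow_mul hy.succ_eq_neg i)
  · simp only [system, ofFn_coeffs]
    exact hpoint i

theorem alternationSet_eq_range (hα : α ∈ Ioo (-1 : ℝ) 1) {y : Fin (n + 2) → ℝ}
    (hy : Alternates (err α (minimaxPoly n α)) (Icc (-1) 1) (minimaxError n α) y)
    (h : extremalSet n α = range y) : alternationSet n α = range y := by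
  refine Subset.antisymm ?_ fun x hx =>
    ⟨n + 2, y, le_rfl, ⟨hy.strictMono, hy.mem, hy.sign⟩, hx⟩
  rintro _ ⟨N, z, -, ⟨hmono, hmem, hsign⟩, i, rfl⟩
  have hz : Alternates (err α (minimaxPoly n α)) (Icc (-1) 1) (minimaxError n α) z :=
    ⟨hmono, hmem, hsign⟩
  exact h ▸ ⟨hmem i, hz.abs_eq (minimaxError_pos n hα).le i⟩

theorem exists_alternates_minimaxPoly (n : ℕ) : ∃ y : ℝ → Fin (n + 2) → ℝ,
    ∀ α ∈ Ioo (-1 : ℝ) 1,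
      Alternates (err α (minimaxPoly n α)) (Icc (-1) 1) (minimaxError n α) (y α) := by
  choose! y hy using fun α (hα : α ∈ Ioo (-1 : ℝ) 1) => (equioscillates_minimaxPoly n hα).alternates
  exact ⟨y, hy⟩

variable {y : ℝ → Fin (n + 2) → ℝ}

theorem Regular.eventually_alternationSet_eq_range (hR : Regular n α₀)
    (hα₀ : α₀ ∈ Ioo (-1 : ℝ) 1) (hy : ∀ α ∈ Ioo (-1 : ℝ) 1,
      Alternates (err α (minimaxPoly n α)) (Icc (-1) 1) (minimaxError n α) (y α)) :
    ∀ᶠ α in 𝓝 α₀, alternationSet n α = range (y α) := by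
  filter_upwards [isOpen_Ioo.mem_nhds hα₀,
    hR.eventually_alternates hα₀ (hy α₀ hα₀) one_pos] with α hα halt
  exact alternationSet_eq_range hα (hy α hα) (halt _ (hy α hα)).2

theorem Regular.continuousAt_alternation (hR : Regular n α₀) (hα₀ : α₀ ∈ Ioo (-1 : ℝ) 1)
    (hy : ∀ α ∈ Ioo (-1 : ℝ) 1,
      Alternates (err α (minimaxPoly n α)) (Icc (-1) 1) (minimaxError n α) (y α)) :
    ContinuousAt y α₀ := by
  refine continuousAt_pi.2 fun i => Metric.tendsto_nhds.2 fun r hr => ?_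
  filter_upwards [isOpen_Ioo.mem_nhds hα₀,
    hR.eventually_alternates hα₀ (hy α₀ hα₀) hr] with α hα halt
  exact (halt _ (hy α hα)).1 i

theorem Regular.eventually_system_eq_zero (hR : Regular n α₀) (hα₀ : α₀ ∈ Ioo (-1 : ℝ) 1)
    (hy : ∀ α ∈ Ioo (-1 : ℝ) 1,
      Alternates (err α (minimaxPoly n α)) (Icc (-1) 1) (minimaxError n α) (y α)) :
    ∀ᶠ α in 𝓝 α₀, system n α₀ (y α₀)
      (α, coeffs n α, err α (minimaxPoly n α) (y α 0), y α) = 0 := by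
  have hgraph (i : Fin (n + 2)) : Tendsto (fun α => (α, y α i)) (𝓝 α₀) (𝓝 (α₀, y α₀ i)) :=
    tendsto_id.prodMk_nhds (continuousAt_pi.1 (hR.continuousAt_alternation hα₀ hy) i)
  have hpoint := eventually_all.2 fun i =>
    (hgraph i).eventually (hR.eventually_pointEq hα₀ ((hy α₀ hα₀).mem i))
  have hsign : ∀ᶠ α in 𝓝 α₀, ∀ i, y α₀ i ≠ α₀ →
      SignType.sign (y α i - α) = SignType.sign (y α₀ i - α₀) := by
    refine eventually_all.2 fun i => eventually_imp_distrib_left.2 fun hi => ?_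
    exact eventually_sign_eq ((continuous_snd.sub continuous_fst).continuousAt.tendsto.comp
      (hgraph i)) (sub_ne_zero.2 hi)
  filter_upwards [isOpen_Ioo.mem_nhds hα₀, hpoint, hsign] with α hα hpoint hsign
  have hzero (i : Fin (n + 2)) := hpoint i
    ⟨(hy α hα).mem i, (hy α hα).abs_eq (minimaxError_pos n hα).le i⟩
  exact (hy α hα).system_eq_zero
    (fun i => sign_mul_sub_eq_abs_of_pointEq hα₀ (hsign i) (hzero i)) hzero

theorem Regular.analyticAt (hR : Regular n α₀) (hα₀ : α₀ ∈ Ioo (-1 : ℝ) 1)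
    (hy : ∀ α ∈ Ioo (-1 : ℝ) 1,
      Alternates (err α (minimaxPoly n α)) (Icc (-1) 1) (minimaxError n α) (y α)) :
    AnalyticAt ℝ (fun α => (coeffs n α, err α (minimaxPoly n α) (y α 0), y α)) α₀ := by
  have hcont := hR.continuousAt_alternation hα₀ hy
  have herr : ContinuousAt (fun α => err α (minimaxPoly n α) (y α 0)) α₀ :=
    (tendsto_err_minimaxPoly n hα₀ (y α₀ 0)).comp
      (tendsto_id.prodMk_nhds (continuousAt_pi.1 hcont 0))
  exact analyticAt_of_implicit (by simp; ring) (contDiff_system n α₀ (y α₀)).contDiffAt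
    (hR.fderiv_system_injective hα₀ (hy α₀ hα₀) _)
    ((continuousAt_coeffs n hα₀).prodMk (herr.prodMk hcont))
    (hR.eventually_system_eq_zero hα₀ hy)

theorem analyticAt_abs_of_ne_zero {f : ℝ → ℝ} {a : ℝ} (hf : AnalyticAt ℝ f a) (ha : f a ≠ 0) :
    AnalyticAt ℝ (fun t => |f t|) a := by
  have hsign : (fun t => (SignType.sign (f a) : ℝ) * f t) =ᶠ[𝓝 a] fun t => |f t| := by
    filter_upwards [eventually_sign_eq hf.continuousAt ha] with t ht
    rw [← ht, sign_mul_self]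
  exact (analyticAt_const.mul hf).congr hsign

theorem analyticAt_minimaxError_of_alternates (hα₀ : α₀ ∈ Ioo (-1 : ℝ) 1)
    (hy : ∀ α ∈ Ioo (-1 : ℝ) 1,
      Alternates (err α (minimaxPoly n α)) (Icc (-1) 1) (minimaxError n α) (y α))
    (h : AnalyticAt ℝ (fun α => err α (minimaxPoly n α) (y α 0)) α₀) :
    AnalyticAt ℝ (minimaxError n) α₀ := by
  have habs : ∀ α ∈ Ioo (-1 : ℝ) 1, |err α (minimaxPoly n α) (y α 0)| = minimaxError n α :=
    fun α hα => (hy α hα).abs_eq (minimaxError_pos n hα).le 0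
  have hne : err α₀ (minimaxPoly n α₀) (y α₀ 0) ≠ 0 := by
    rw [← abs_pos, habs α₀ hα₀]
    exact minimaxError_pos n hα₀
  exact (analyticAt_abs_of_ne_zero h hne).congr
    (eventually_of_mem (isOpen_Ioo.mem_nhds hα₀) habs)

theorem analyticAt_coeff_minimaxPoly (h : AnalyticAt ℝ (coeffs n) α₀) (j : ℕ) :
    AnalyticAt ℝ (fun α => (minimaxPoly n α).coeff j) α₀ := by
  rcases lt_or_ge j (n + 1) with hj | hj
  · exact analyticAt_pi_iff.1 h ⟨j, hj⟩
  · have hzero : (fun α => (minimaxPoly n α).coeff j) = fun _ => 0 := funext fun α =>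
      coeff_eq_zero_of_natDegree_lt (Nat.lt_of_le_of_lt (minimaxPoly_isMinimax n α).natDegree_le hj)
    exact hzero ▸ analyticAt_const

end Analyticity

end Checkmark

end

theorem mainTheorem3 (n : ℕ) (α₀ : ℝ) (hα₀ : α₀ ∈ Set.Ioo (-1 : ℝ) 1)
    (hV : ∀ a b c : ℝ, Checkmark.IsVShape (Checkmark.minimaxError n) a b c →
      α₀ ≠ a ∧ α₀ ≠ b ∧ α₀ ≠ c) :
    AnalyticAt ℝ (fun α => Checkmark.minimaxError n α) α₀ ∧
    (∃ z : Fin (n + 2) → ℝ → ℝ,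
      (∀ i, AnalyticAt ℝ (z i) α₀) ∧
      ∀ᶠ α in 𝓝 α₀, StrictMono (fun i => z i α) ∧
        Checkmark.alternationSet n α = Set.range (fun i => z i α)) ∧
    (∀ j : ℕ, AnalyticAt ℝ (fun α => (Checkmark.minimaxPoly n α).coeff j) α₀) := by
  have hR : Checkmark.Regular n α₀ := Checkmark.regular_of_forall_isVShape_ne hα₀ hV
  obtain ⟨y, hy⟩ := Checkmark.exists_alternates_minimaxPoly n
  have hanalytic := hR.analyticAt hα₀ hy
  have hcoeffs : AnalyticAt ℝ (Checkmark.coeffs n) α₀ := analyticAt_fst.comp hanalytic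
  have hpoints : AnalyticAt ℝ y α₀ := analyticAt_snd.comp (analyticAt_snd.comp hanalytic)
  refine ⟨Checkmark.analyticAt_minimaxError_of_alternates hα₀ hy
      (analyticAt_fst.comp (analyticAt_snd.comp hanalytic)),
    ⟨fun i α => y α i, analyticAt_pi_iff.1 hpoints, ?_⟩,
    Checkmark.analyticAt_coeff_minimaxPoly hcoeffs⟩
  filter_upwards [isOpen_Ioo.mem_nhds hα₀, hR.eventually_alternationSet_eq_range hα₀ hy]
    with α hα hrange
  exact ⟨(hy α hα).strictMono, hrange⟩
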